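/- Let $d\ge 1$, let $\Omega\subset\mathbb R^d$ be a nonempty bounded convex open set of class $C^3$ (its boundary is locally the graph of a $C^3$ function) with outward unit normal $\vec\nu$, let $T>0$ and $Q=(0,T)\times\Omega$. Let $H\in C^2(\mathbb R^d)$ satisfy, for some $q>1$, $\alpha,\beta>0$ and $\varpi\ge 0$, $$\alpha(|p|+\varpi)^{q-2}I_d\le H_{pp}(p)\le \beta(|p|+\varpi)^{q-2}I_d\qquad\text{for all } p\ne 0 .$$ Let $f:(0,\infty)\to\mathbb R$ be nondecreasing and $C^1$, let $\varepsilon>0$, $f^\varepsilon(s)=f(s)+\varepsilon\log s$, let $V$ be Lipschitz continuous on $\Omega$, and let $m_0,m_1\in L^\infty(\Omega)$ be probability densities on $\Omega$. Let $u\in C^2(Q)\cap C^1(\overline Q)$ and $m\in C^1(Q)\cap C^0(\overline Q)$, $m>0$ on $\overline Q$, be a classical solution of $$-u_t+H(Du)=f(m)+\varepsilon\log m+V(x),\qquad m_t-\operatorname{div}(m\,H_p(Du))=0\quad\text{in }Q,\qquad H_p(Du)\cdot\vec\nu=0\ \text{ on }(0,T)\times\partial\Omega,$$ with either the planning conditions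 $m(0)=m_0$, $m(T)=m_1$ in $\Omega$, or, for some $\delta>0$ and with $m_0,m_1>0$ a.e., the penalized conditions $$u(0)=\frac{f^\varepsilon(m_0)-f^\varepsilon(m(0))}{\delta},\qquad u(T)=\frac{f^\varepsilon(m(T))-f^\varepsilon(m_1)}{\delta}\quad\text{in }\Omega .$$ Set $\hat u:=u-\int_\Omega u(T)\,m_1\,dx$. (1) Global estimate. Suppose that $H_p(0)=0$ (in particular, this holds if $H$ is radial). Then $|\hat u|\le C$ on $\overline Q$, where, given $\Omega,T,H,f$, the constant $C$ depends only on upper bounds for $\varepsilon$, $\|m\|_\infty$, $\|\varepsilon\log m_0\|_\infty$, $\|\varepsilon\log m_1\|_\infty$, $\|V\|_{W^{1,\infty}(\Omega)}$, and on a lower bound for $f(m_0)$ and $f(m_1)$. (If $f$ is bounded below, the last dependence is void.) In particular $C$ does not depend on $\delta$. (2) Local estimates. For all $(t,x)\in Q$, $$\hat u(t,x)\le\frac{C_1}{(T-t)^{1/(q-1)}},$$ where, given $\Omega,T,H$ and $q$, the constant $C_1$ depends only on an upper bound for $\sup_Q(f^\varepsilon(m)+V)$. If, in addition, $s f(s)$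 is bounded below on $(0,1]$ (equivalently, $s f^\varepsilon(s)$ is bounded below on $(0,\infty)$), then for all $(t,x)\in Q$, $$\hat u(t,x)\ge-\frac{C_0}{t^{1/(q-1)}},$$ where, given $\Omega,T,H,q$ and $f$, the constant $C_0$ depends only on upper bounds for $\sup_Q(f^\varepsilon(m)+V)$, $\|V\|_\infty$ and $\varepsilon$. In particular $C_0,C_1$ do not depend on $\delta$, $m_0$ or $m_1$. -/

import Mathlib

open MeasureTheory Set

/-- `Ω` is a nonempty bounded convex open set whose boundary is locally the graph of a `C³` function:
near each boundary point, for some unit vector `e`, `Ω` is the set of the points below the graph of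
a `C³` function of the component of `x` orthogonal to `e`. -/
structure IsC3ConvexDomain {d : ℕ} (Ω : Set (EuclideanSpace ℝ (Fin d))) : Prop where
  nonempty : Ω.Nonempty
  isOpen : IsOpen Ω
  bounded : Bornology.IsBounded Ω
  convex : Convex ℝ Ω
  boundary : ∀ x₀ ∈ frontier Ω, ∃ (e : EuclideanSpace ℝ (Fin d)) (r : ℝ)
    (g : EuclideanSpace ℝ (Fin d) → ℝ), ‖e‖ = 1 ∧ 0 < r ∧ ContDiff ℝ 3 g ∧
      ∀ x ∈ Metric.ball x₀ r, x ∈ Ω ↔ inner ℝ e x < g (x - (inner ℝ e x : ℝ) • e)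

/-- `ν` is an outward unit normal at the boundary point `x` of the convex set `Ω`. (It is unique when
the boundary is of class `C¹`.) -/
def IsOutwardUnitNormal {d : ℕ} (Ω : Set (EuclideanSpace ℝ (Fin d)))
    (x ν : EuclideanSpace ℝ (Fin d)) : Prop :=
  ‖ν‖ = 1 ∧ ∀ y ∈ Ω, inner ℝ ν (y - x) ≤ 0

/-- Divergence of a vector field. -/
noncomputable def divergence {d : ℕ} (F : EuclideanSpace ℝ (Fin d) → EuclideanSpace ℝ (Fin d))
    (x : EuclideanSpace ℝ (Fin d)) : ℝ :=
  ∑ i : Fin d, (fderiv ℝ F x (EuclideanSpace.single i 1)) i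

/-- The Hamiltonian `H` is of class `C²` and, for some `α, β > 0` and `ϖ ≥ 0`,
`α (|p| + ϖ)^(q-2) I ≤ D²H(p) ≤ β (|p| + ϖ)^(q-2) I` for all `p ≠ 0`. -/
def IsPowerHamiltonian {d : ℕ} (q : ℝ) (H : EuclideanSpace ℝ (Fin d) → ℝ) : Prop :=
  ContDiff ℝ 2 H ∧ ∃ α β ϖ : ℝ, 0 < α ∧ 0 < β ∧ 0 ≤ ϖ ∧
    ∀ p : EuclideanSpace ℝ (Fin d), p ≠ 0 → ∀ ξ : EuclideanSpace ℝ (Fin d),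
      α * (‖p‖ + ϖ) ^ (q - 2) * ‖ξ‖ ^ 2 ≤ fderiv ℝ (fderiv ℝ H) p ξ ξ ∧
      fderiv ℝ (fderiv ℝ H) p ξ ξ ≤ β * (‖p‖ + ϖ) ^ (q - 2) * ‖ξ‖ ^ 2

/-- The coupling `f` is a nondecreasing `C¹` function on `(0, ∞)`. -/
def IsCoupling (f : ℝ → ℝ) : Prop :=
  ContDiffOn ℝ 1 f (Ioi 0) ∧ MonotoneOn f (Ioi 0)

/-- `f^ε(s) = f(s) + ε log s`. -/
noncomputable def fEps (f : ℝ → ℝ) (ε s : ℝ) : ℝ := f s + ε * Real.log s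

/-- `m₀` is the density of a probability measure on `Ω`, and belongs to `L^∞(Ω)`. -/
def IsBoundedDensity {d : ℕ} (Ω : Set (EuclideanSpace ℝ (Fin d)))
    (m₀ : EuclideanSpace ℝ (Fin d) → ℝ) : Prop :=
  MemLp m₀ ⊤ (volume.restrict Ω) ∧ (∀ᵐ x ∂volume.restrict Ω, 0 ≤ m₀ x) ∧ ∫ x in Ω, m₀ x = 1

/-- `V` is bounded by `R` and Lipschitz continuous with constant `R` on `Ω`. -/
def W1InftyBound {d : ℕ} (Ω : Set (EuclideanSpace ℝ (Fin d)))
    (V : EuclideanSpace ℝ (Fin d) → ℝ) (R : ℝ) : Prop :=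
  (∀ x ∈ Ω, |V x| ≤ R) ∧ ∀ x ∈ Ω, ∀ y ∈ Ω, |V x - V y| ≤ R * ‖x - y‖

/-- `(u, m)` is a classical solution, in `Q = (0, T) × Ω`, of
`-u_t + H(Du) = f(m) + ε log m + V` and `m_t - div (m H_p(Du)) = 0`, with
`H_p(Du) · ν = 0` on `(0, T) × ∂Ω`. On the boundary `Du` is the gradient of the function
`u t`, which is `C¹` on the closure of `Ω`. -/
structure IsClassicalPair {d : ℕ} (Ω : Set (EuclideanSpace ℝ (Fin d))) (T : ℝ)
    (H : EuclideanSpace ℝ (Fin d) → ℝ) (f : ℝ → ℝ) (ε : ℝ) (V : EuclideanSpace ℝ (Fin d) → ℝ)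
    (u m : ℝ → EuclideanSpace ℝ (Fin d) → ℝ) : Prop where
  u_C2 : ContDiffOn ℝ 2 (fun z : ℝ × EuclideanSpace ℝ (Fin d) => u z.1 z.2) (Ioo 0 T ×ˢ Ω)
  u_C1 : ContDiffOn ℝ 1 (fun z : ℝ × EuclideanSpace ℝ (Fin d) => u z.1 z.2)
    (Icc 0 T ×ˢ closure Ω)
  m_C1 : ContDiffOn ℝ 1 (fun z : ℝ × EuclideanSpace ℝ (Fin d) => m z.1 z.2) (Ioo 0 T ×ˢ Ω)
  m_C0 : ContinuousOn (fun z : ℝ × EuclideanSpace ℝ (Fin d) => m z.1 z.2) (Icc 0 T ×ˢ closure Ω)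
  m_pos : ∀ t ∈ Icc 0 T, ∀ x ∈ closure Ω, 0 < m t x
  hamiltonJacobi : ∀ t ∈ Ioo 0 T, ∀ x ∈ Ω,
    -deriv (fun s => u s x) t + H (gradient (u t) x) = fEps f ε (m t x) + V x
  continuity : ∀ t ∈ Ioo 0 T, ∀ x ∈ Ω,
    deriv (fun s => m s x) t
      - divergence (fun y => m t y • gradient H (gradient (u t) y)) x = 0
  neumann : ∀ t ∈ Ioo 0 T, ∀ x ∈ frontier Ω, ∀ ν, IsOutwardUnitNormal Ω x ν →
    inner ℝ (gradient H (gradientWithin (u t) (closure Ω) x)) ν = 0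

/-- `(u, m)` is a classical solution of the planning problem: `m(0) = m₀`, `m(T) = m₁`. -/
def IsPlanningSolution {d : ℕ} (Ω : Set (EuclideanSpace ℝ (Fin d))) (T : ℝ)
    (H : EuclideanSpace ℝ (Fin d) → ℝ) (f : ℝ → ℝ) (ε : ℝ)
    (V m₀ m₁ : EuclideanSpace ℝ (Fin d) → ℝ)
    (u m : ℝ → EuclideanSpace ℝ (Fin d) → ℝ) : Prop :=
  IsClassicalPair Ω T H f ε V u m ∧
    (∀ᵐ x ∂volume.restrict Ω, m 0 x = m₀ x) ∧ (∀ᵐ x ∂volume.restrict Ω, m T x = m₁ x)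

/-- `(u, m)` is a classical solution of the penalized problem: `m₀, m₁ > 0` and
`u(0) = (f^ε(m₀) - f^ε(m(0))) / δ`, `u(T) = (f^ε(m(T)) - f^ε(m₁)) / δ`. -/
def IsPenalizedSolution {d : ℕ} (Ω : Set (EuclideanSpace ℝ (Fin d))) (T : ℝ)
    (H : EuclideanSpace ℝ (Fin d) → ℝ) (f : ℝ → ℝ) (ε δ : ℝ)
    (V m₀ m₁ : EuclideanSpace ℝ (Fin d) → ℝ)
    (u m : ℝ → EuclideanSpace ℝ (Fin d) → ℝ) : Prop :=
  IsClassicalPair Ω T H f ε V u m ∧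
    (∀ᵐ x ∂volume.restrict Ω, 0 < m₀ x) ∧ (∀ᵐ x ∂volume.restrict Ω, 0 < m₁ x) ∧
    (∀ᵐ x ∂volume.restrict Ω, u 0 x = (fEps f ε (m₀ x) - fEps f ε (m 0 x)) / δ) ∧
    (∀ᵐ x ∂volume.restrict Ω, u T x = (fEps f ε (m T x) - fEps f ε (m₁ x)) / δ)

/-- `m₀, m₁` are bounded probability densities, `V` is Lipschitz continuous on `Ω`, and `(u, m)` is a
classical solution of the planning problem or, for some `δ > 0`, of the penalized problem. -/
def IsPlanningOrPenalizedSolution {d : ℕ} (Ω : Set (EuclideanSpace ℝ (Fin d))) (T : ℝ)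
    (H : EuclideanSpace ℝ (Fin d) → ℝ) (f : ℝ → ℝ) (ε : ℝ)
    (V m₀ m₁ : EuclideanSpace ℝ (Fin d) → ℝ)
    (u m : ℝ → EuclideanSpace ℝ (Fin d) → ℝ) : Prop :=
  IsBoundedDensity Ω m₀ ∧ IsBoundedDensity Ω m₁ ∧ (∃ L, LipschitzOnWith L V Ω) ∧
    (IsPlanningSolution Ω T H f ε V m₀ m₁ u m ∨
      ∃ δ : ℝ, 0 < δ ∧ IsPenalizedSolution Ω T H f ε δ V m₀ m₁ u m)

/-- The normalization `û = u - ∫_Ω u(T) m₁ dx`. -/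
noncomputable def normalized {d : ℕ} (Ω : Set (EuclideanSpace ℝ (Fin d))) (T : ℝ)
    (m₁ : EuclideanSpace ℝ (Fin d) → ℝ) (u : ℝ → EuclideanSpace ℝ (Fin d) → ℝ)
    (t : ℝ) (x : EuclideanSpace ℝ (Fin d)) : ℝ :=
  u t x - ∫ y in Ω, u T y * m₁ y

namespace PlanningProblem

open Filter Topology

section Hamiltonian

variable {d : ℕ} {q : ℝ} {H : EuclideanSpace ℝ (Fin d) → ℝ}

lemma hessian_nonneg (hH : IsPowerHamiltonian q H) (p ξ : EuclideanSpace ℝ (Fin d)) :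
    0 ≤ fderiv ℝ (fderiv ℝ H) p ξ ξ := by
  obtain ⟨hC, α, β, ϖ, hα, -, hϖ, hb⟩ := hH
  have key : ∀ p : EuclideanSpace ℝ (Fin d), p ≠ 0 → 0 ≤ fderiv ℝ (fderiv ℝ H) p ξ ξ := by
    intro p hp
    refine le_trans ?_ (hb p hp ξ).1
    positivity
  rcases eq_or_ne p 0 with rfl | hp
  · rcases eq_or_ne ξ 0 with rfl | hξ
    · simp
    · have hc : Continuous fun s : ℝ => fderiv ℝ (fderiv ℝ H) (s • ξ) ξ ξ := by
        have h1 : Continuous (fderiv ℝ (fderiv ℝ H)) :=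
          (hC.fderiv_right (m := 1) (by norm_num)).continuous_fderiv (by norm_num)
        have h2 : Continuous fun s : ℝ => fderiv ℝ (fderiv ℝ H) (s • ξ) :=
          h1.comp (by fun_prop)
        fun_prop
      have ht : Tendsto (fun s : ℝ => fderiv ℝ (fderiv ℝ H) (s • ξ) ξ ξ) (𝓝[≠] 0)
          (𝓝 (fderiv ℝ (fderiv ℝ H) 0 ξ ξ)) := by
        have := hc.tendsto 0
        rw [zero_smul] at this
        exact this.mono_left nhdsWithin_le_nhds
      refine ge_of_tendsto ht ?_
      filter_upwards [self_mem_nhdsWithin] with s hs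
      exact key _ (smul_ne_zero hs hξ)
  · exact key p hp

lemma hasDerivAt_line (hH : ContDiff ℝ 2 H) (p v : EuclideanSpace ℝ (Fin d)) (s : ℝ) :
    HasDerivAt (fun s : ℝ => H (p + s • v)) (fderiv ℝ H (p + s • v) v) s := by
  have h1 : HasDerivAt (fun s : ℝ => p + s • v) v s := by
    simpa using ((hasDerivAt_id s).smul_const v).const_add p
  exact ((hH.differentiable (by norm_num)) _).hasFDerivAt.comp_hasDerivAt s h1

lemma hasDerivAt_fderiv_line (hH : ContDiff ℝ 2 H) (p v : EuclideanSpace ℝ (Fin d)) (s : ℝ) :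
    HasDerivAt (fun s : ℝ => fderiv ℝ H (p + s • v) v)
      (fderiv ℝ (fderiv ℝ H) (p + s • v) v v) s := by
  have h1 : HasDerivAt (fun s : ℝ => p + s • v) v s := by
    simpa using ((hasDerivAt_id s).smul_const v).const_add p
  have h2 := (((hH.fderiv_right (m := 1) (by norm_num)).differentiable (by norm_num))
    (p + s • v)).hasFDerivAt.comp_hasDerivAt s h1
  simpa using h2.clm_apply (hasDerivAt_const s v)

lemma monotone_fderiv_line (hH : IsPowerHamiltonian q H) (p v : EuclideanSpace ℝ (Fin d)) :
    Monotone (fun s : ℝ => fderiv ℝ H (p + s • v) v) := by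
  refine monotone_of_deriv_nonneg
    (fun s => (hasDerivAt_fderiv_line hH.1 p v s).differentiableAt) fun s => ?_
  rw [(hasDerivAt_fderiv_line hH.1 p v s).deriv]
  exact hessian_nonneg hH _ _

/-- A differentiable function lies above its tangent line at the left end point where its derivative
is nondecreasing. -/
lemma tangent_le_of_monotoneOn {φ φ' : ℝ → ℝ} {a b : ℝ} (hab : a ≤ b)
    (hφ : ∀ s ∈ Icc a b, HasDerivAt φ (φ' s) s) (hm : ∀ s ∈ Icc a b, φ' a ≤ φ' s) :
    φ a + φ' a * (b - a) ≤ φ b := by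
  rcases hab.eq_or_lt with rfl | hlt
  · simp
  obtain ⟨c, hc, h⟩ := exists_hasDerivAt_eq_slope φ φ' hlt
    (fun s hs => (hφ s hs).continuousAt.continuousWithinAt) (fun s hs => hφ s (Ioo_subset_Icc_self hs))
  have h1 := hm c (Ioo_subset_Icc_self hc)
  rw [h, le_div_iff₀ (sub_pos.2 hlt)] at h1
  linarith

lemma tangent_le (hH : IsPowerHamiltonian q H) (p v : EuclideanSpace ℝ (Fin d)) :
    H p + fderiv ℝ H p v ≤ H (p + v) := by
  have := tangent_le_of_monotoneOn (φ := fun s : ℝ => H (p + s • v)) (zero_le_one' ℝ)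
    (fun s _ => hasDerivAt_line hH.1 p v s) (fun s hs => monotone_fderiv_line hH p v hs.1)
  simpa using this

lemma exists_coercive (hq : 1 < q) (hH : IsPowerHamiltonian q H) :
    ∃ κ A : ℝ, 0 < κ ∧ 0 ≤ A ∧ ∀ p, κ * ‖p‖ ^ q - A * (1 + ‖p‖) ≤ H p := by
  have hH' := hH
  obtain ⟨hC, α, β, ϖ, hα, -, hϖ, hb⟩ := hH'
  set c := α * min 1 ((1 + ϖ) ^ (q - 2)) with hc
  have hc0 : 0 < c := mul_pos hα (lt_min one_pos (Real.rpow_pos_of_pos (by linarith) _))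
  have hlow : ∀ s : ℝ, 1 ≤ s → c * s ^ (q - 2) ≤ α * (s + ϖ) ^ (q - 2) := by
    intro s hs
    have hs0 : 0 < s := by linarith
    rw [hc, mul_assoc]
    refine mul_le_mul_of_nonneg_left ?_ hα.le
    rcases le_total 2 q with h2 | h2
    · calc min 1 ((1 + ϖ) ^ (q - 2)) * s ^ (q - 2) ≤ 1 * s ^ (q - 2) := by
            gcongr
            exact min_le_left _ _
        _ ≤ _ := by
            rw [one_mul]
            exact Real.rpow_le_rpow hs0.le (by linarith) (by linarith)
    · calc min 1 ((1 + ϖ) ^ (q - 2)) * s ^ (q - 2) ≤ (1 + ϖ) ^ (q - 2) * s ^ (q - 2) := by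
            gcongr
            exact min_le_right _ _
        _ = ((1 + ϖ) * s) ^ (q - 2) := (Real.mul_rpow (by linarith) hs0.le).symm
        _ ≤ _ := Real.rpow_le_rpow_of_nonpos (by linarith) (by nlinarith) (by linarith)
  set κ := c / (q * (q - 1)) with hκ
  have hq1 : 0 < q - 1 := by linarith
  have hq0 : 0 < q := by linarith
  have hκ0 : 0 < κ := by positivity
  set N := ‖fderiv ℝ H 0‖ with hN
  have hN0 : 0 ≤ N := norm_nonneg _
  have htan : ∀ p, H 0 - N * ‖p‖ ≤ H p := by
    intro p
    have h1 := tangent_le hH 0 p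
    have h2 := (abs_le.1 ((fderiv ℝ H 0).le_opNorm p)).1
    rw [zero_add] at h1
    linarith
  refine ⟨κ, |H 0| + N + κ + κ * q, hκ0, by positivity, fun p => ?_⟩
  rcases le_total ‖p‖ 1 with hp | hp
  · have h1 := htan p
    have h2 : ‖p‖ ^ q ≤ 1 := Real.rpow_le_one (norm_nonneg _) hp hq0.le
    have h3 := neg_abs_le (H 0)
    have h4 : 0 ≤ |H 0| := abs_nonneg _
    nlinarith [norm_nonneg p, mul_nonneg h4 (norm_nonneg p), mul_nonneg hκ0.le (norm_nonneg p),
      mul_nonneg (mul_pos hκ0 hq0).le (norm_nonneg p), mul_pos hκ0 hq0]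
  · have hp0 : p ≠ 0 := by
      rintro rfl
      simp at hp
      linarith
    set e := ‖p‖⁻¹ • p with he
    have hpn : 0 < ‖p‖ := norm_pos_iff.2 hp0
    have hen : ‖e‖ = 1 := norm_smul_inv_norm hp0
    have hpe : ‖p‖ • e = p := by rw [he, smul_smul, mul_inv_cancel₀ hpn.ne', one_smul]
    have hd1 : ∀ s : ℝ, 0 < s → HasDerivAt (fun s : ℝ => H (0 + s • e) - κ * s ^ q)
        (fderiv ℝ H (0 + s • e) e - κ * (q * s ^ (q - 1))) s := fun s hs =>
      (hasDerivAt_line hC 0 e s).sub ((Real.hasDerivAt_rpow_const (Or.inl hs.ne')).const_mul κ)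
    have hd2 : ∀ s : ℝ, 0 < s →
        HasDerivAt (fun s : ℝ => fderiv ℝ H (0 + s • e) e - κ * (q * s ^ (q - 1)))
        (fderiv ℝ (fderiv ℝ H) (0 + s • e) e e - κ * (q * ((q - 1) * s ^ (q - 1 - 1)))) s :=
      fun s hs => (hasDerivAt_fderiv_line hC 0 e s).sub
        (((Real.hasDerivAt_rpow_const (Or.inl hs.ne')).const_mul q).const_mul κ)
    have hmono : MonotoneOn (fun s : ℝ => fderiv ℝ H (0 + s • e) e - κ * (q * s ^ (q - 1)))
        (Ici 1) := by
      refine monotoneOn_of_deriv_nonneg (convex_Ici 1) (fun s hs => ?_) (fun s hs => ?_)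
        (fun s hs => ?_)
      · exact (hd2 s (zero_lt_one.trans_le hs)).continuousAt.continuousWithinAt
      · rw [interior_Ici] at hs
        exact (hd2 s (zero_lt_one.trans hs)).differentiableAt.differentiableWithinAt
      · rw [interior_Ici] at hs
        have hs0 : (0 : ℝ) < s := zero_lt_one.trans hs
        rw [(hd2 s hs0).deriv]
        have h1 := (hb (s • e) (smul_ne_zero hs0.ne' (by rintro h; simp [h] at hen)) e).1
        rw [norm_smul, hen, Real.norm_eq_abs, abs_of_pos hs0] at h1
        have h2 := hlow s (le_of_lt hs)
        have h3 : κ * (q * ((q - 1) * s ^ (q - 1 - 1))) = c * s ^ (q - 2) := by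
          rw [hκ, show q - 1 - 1 = q - 2 by ring]
          field_simp
        rw [h3, zero_add]
        simp only [mul_one, one_pow] at h1
        linarith
    have h1 := tangent_le_of_monotoneOn hp
      (fun s hs => hd1 s (zero_lt_one.trans_le hs.1))
      (fun s hs => hmono (mem_Ici.2 le_rfl) (mem_Ici.2 hs.1) hs.1)
    have h2 := monotone_fderiv_line hH 0 e (zero_le_one' ℝ)
    have h3 := htan e
    have h4 : -N ≤ fderiv ℝ H 0 e := by
      have := (abs_le.1 ((fderiv ℝ H 0).le_opNorm e)).1
      rwa [hen, mul_one] at this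
    simp only [zero_add, one_smul, Real.one_rpow, mul_one, hpe, zero_smul, hen] at h1 h2 h3
    have h5 : -(N + κ * q) * (‖p‖ - 1) ≤ ((fderiv ℝ H e) e - κ * q) * (‖p‖ - 1) :=
      mul_le_mul_of_nonneg_right (by linarith) (by linarith)
    have h6 := neg_abs_le (H 0)
    have h7 : 0 ≤ |H 0| := abs_nonneg _
    nlinarith [mul_nonneg h7 hpn.le, mul_nonneg hκ0.le hpn.le, mul_pos hκ0 hq0]

lemma exists_lagrangian_bound (hq : 1 < q) (hH : IsPowerHamiltonian q H) :
    ∃ A : ℝ, 0 ≤ A ∧ ∀ p v : EuclideanSpace ℝ (Fin d),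
      -(A * (1 + ‖v‖) ^ (q / (q - 1))) ≤ H p + inner ℝ p v := by
  obtain ⟨κ, A, hκ, hA, hb⟩ := exists_coercive hq hH
  have hq1 : 0 < q - 1 := by linarith
  have hq0 : 0 < q := by linarith
  set a := κ ^ (1 / q) with ha
  have ha0 : 0 < a := Real.rpow_pos_of_pos hκ _
  have haq : a ^ q = κ := by
    rw [ha, ← Real.rpow_mul hκ.le, one_div_mul_cancel hq0.ne', Real.rpow_one]
  have hconj : q.HolderConjugate (q / (q - 1)) := Real.HolderConjugate.conjExponent hq
  refine ⟨A + ((A + 1) / a) ^ (q / (q - 1)), by positivity, fun p v => ?_⟩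
  have h1 := hb p
  have h2 := (abs_le.1 (abs_real_inner_le_norm p v)).1
  have hv : 0 ≤ ‖v‖ := norm_nonneg _
  have hp : 0 ≤ ‖p‖ := norm_nonneg _
  have hy := Real.young_inequality_of_nonneg (a := ‖p‖ * a) (b := (A + 1) / a * (1 + ‖v‖))
    (by positivity) (by positivity) hconj
  rw [Real.mul_rpow hp ha0.le, haq, Real.mul_rpow (by positivity) (by positivity)] at hy
  have e1 : ‖p‖ * a * ((A + 1) / a * (1 + ‖v‖)) = ‖p‖ * ((A + 1) * (1 + ‖v‖)) := by
    field_simp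
  rw [e1] at hy
  have h3 : ‖p‖ ^ q * κ / q ≤ ‖p‖ ^ q * κ :=
    div_le_self (by positivity) hq.le
  have h4 : ((A + 1) / a) ^ (q / (q - 1)) * (1 + ‖v‖) ^ (q / (q - 1)) / (q / (q - 1)) ≤
      ((A + 1) / a) ^ (q / (q - 1)) * (1 + ‖v‖) ^ (q / (q - 1)) := by
    refine div_le_self (by positivity) ?_
    rw [le_div_iff₀ hq1]
    linarith
  have h5 : 1 ≤ (1 + ‖v‖) ^ (q / (q - 1)) := Real.one_le_rpow (by linarith) (by positivity)
  nlinarith [mul_nonneg hA hp, mul_nonneg hA hv, mul_nonneg hp hv, mul_nonneg (mul_nonneg hA hp) hv]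

end Hamiltonian

/-- A Lipschitz cutoff of the convex set `Ω` at distance `η` from the boundary, whose gradient is
an inward normal at a nearby boundary point. -/
structure IsBoundaryCutoff {d : ℕ} (Ω : Set (EuclideanSpace ℝ (Fin d))) (C η : ℝ)
    (χ : EuclideanSpace ℝ (Fin d) → ℝ) : Prop where
  lipschitz : LipschitzWith (C / η).toNNReal χ
  nonneg : ∀ x, 0 ≤ χ x
  le_one : ∀ x, χ x ≤ 1
  hasCompactSupport : HasCompactSupport χ
  tsupport_subset : tsupport χ ⊆ Ω
  measure_le : volume.real {x ∈ Ω | χ x ≠ 1} ≤ C * η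
  normal : ∀ x, DifferentiableAt ℝ χ x → fderiv ℝ χ x ≠ 0 → χ x ≠ 1 ∧
    ∃ y ∈ frontier Ω, ‖x - y‖ ≤ C * η ∧ ∃ ν, IsOutwardUnitNormal Ω y ν ∧
      ∀ w, fderiv ℝ χ x w = -(‖fderiv ℝ χ x‖ * inner ℝ ν w)

section Cutoff

variable {d : ℕ} {Ω : Set (EuclideanSpace ℝ (Fin d))}

lemma measureReal_sdiff_homothety_le (hΩ : Convex ℝ Ω) (ho : IsOpen Ω)
    (hb : Bornology.IsBounded Ω) {x₀ : EuclideanSpace ℝ (Fin d)} (hx₀ : x₀ ∈ Ω) {r : ℝ}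
    (hr0 : 0 < r) (hr1 : r ≤ 1) :
    volume.real (Ω \ AffineMap.homothety x₀ r '' Ω) ≤ d * (1 - r) * volume.real Ω := by
  have hsub : AffineMap.homothety x₀ r '' Ω ⊆ Ω := by
    rintro _ ⟨x, hx, rfl⟩
    rw [AffineMap.homothety_eq_lineMap]
    exact hΩ.lineMap_mem hx₀ hx ⟨hr0.le, hr1⟩
  have hfin : volume Ω ≠ ⊤ := hb.measure_lt_top.ne
  have hmeas : MeasurableSet (AffineMap.homothety x₀ r '' Ω) := by
    refine IsOpen.measurableSet ?_
    exact (AffineMap.homothety_isOpenMap x₀ r hr0.ne') _ ho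
  rw [measureReal_sdiff hsub hmeas hfin]
  have hvol : volume.real (AffineMap.homothety x₀ r '' Ω) = r ^ d * volume.real Ω := by
    rw [measureReal_def, Measure.addHaar_image_homothety, ENNReal.toReal_mul,
      ENNReal.toReal_ofReal (abs_nonneg _), finrank_euclideanSpace_fin, abs_of_pos (by positivity)]
    rfl
  rw [hvol]
  have hB := one_add_mul_le_pow (a := r - 1) (by linarith) d
  rw [add_sub_cancel] at hB
  have hv : 0 ≤ volume.real Ω := measureReal_nonneg
  nlinarith

lemma nonneg_fderiv_of_segment_le {χ : EuclideanSpace ℝ (Fin d) → ℝ}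
    {x z : EuclideanSpace ℝ (Fin d)} (hd : DifferentiableAt ℝ χ x)
    (h : ∀ y ∈ segment ℝ x z, χ x ≤ χ y) : 0 ≤ fderiv ℝ χ x (z - x) := by
  have h1 : IsLocalMinOn χ (segment ℝ x z) x := by
    filter_upwards [self_mem_nhdsWithin] with y hy using h y hy
  exact h1.hasFDerivWithinAt_nonneg hd.hasFDerivAt.hasFDerivWithinAt
    (sub_mem_posTangentConeAt_of_segment_subset le_rfl)

lemma exists_boundaryCutoff (hΩ : Convex ℝ Ω) (ho : IsOpen Ω) (hb : Bornology.IsBounded Ω)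
    (hne : Ω.Nonempty) :
    ∃ C : ℝ, 0 < C ∧ ∀ η : ℝ, 0 < η → η ≤ 1 / 4 → ∃ χ, IsBoundaryCutoff Ω C η χ := by
  obtain ⟨x₀, hx₀⟩ := hne
  obtain ⟨D, hD0, hD⟩ : ∃ D : ℝ, 0 < D ∧ ∀ x ∈ Ω, ‖x - x₀‖ ≤ D := by
    obtain ⟨D, hD0, hD⟩ := hb.subset_closedBall_lt 0 x₀
    exact ⟨D, hD0, fun x hx => by simpa [dist_eq_norm] using hD hx⟩
  set S : Set (EuclideanSpace ℝ (Fin d)) := (fun z => x₀ + z) ⁻¹' Ω with hS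
  have hSc : Convex ℝ S := hΩ.translate_preimage_right x₀
  have hSo : IsOpen S := ho.preimage (by fun_prop)
  have hS0 : S ∈ 𝓝 0 := hSo.mem_nhds (by simpa [hS] using hx₀)
  have hSa : Absorbent ℝ S := absorbent_nhds_zero hS0
  obtain ⟨K, hK⟩ := hSc.lipschitz_gauge hS0
  set γ : EuclideanSpace ℝ (Fin d) → ℝ := fun x => gauge S (x - x₀) with hγ
  have hγL : LipschitzWith K γ := by
    refine LipschitzWith.of_dist_le_mul fun x y => ?_
    simpa [hγ] using hK.dist_le_mul (x - x₀) (y - x₀)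
  have hγlt : ∀ x, γ x < 1 ↔ x ∈ Ω := by
    intro x
    rw [hγ]
    simp only
    rw [gauge_lt_one_iff_mem_interior hSc hS0, hSo.interior_eq]
    simp [hS]
  have hγfr : ∀ x, γ x = 1 → x ∈ frontier Ω := by
    intro x hx
    rw [hγ] at hx
    simp only at hx
    rw [gauge_eq_one_iff_mem_frontier hSc hS0] at hx
    have h1 := (Homeomorph.addLeft x₀).preimage_frontier Ω
    have h2 : x - x₀ ∈ (Homeomorph.addLeft x₀) ⁻¹' frontier Ω := by
      rw [h1]
      exact hx
    simpa using h2
  have hγ0 : ∀ x, 0 ≤ γ x := fun x => gauge_nonneg _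
  have hγhom : ∀ (r : ℝ) z, 0 ≤ r → γ (x₀ + r • z) = r * γ (x₀ + z) := by
    intro r z hr
    simp only [hγ, add_sub_cancel_left]
    rw [gauge_smul_of_nonneg hr, smul_eq_mul]
  set V := volume.real Ω with hV
  have hV0 : 0 ≤ V := measureReal_nonneg
  refine ⟨K + 2 * d * V + 4 * D, by positivity, fun η hη hη4 => ?_⟩
  set C := K + 2 * d * V + 4 * D with hC
  set χ : EuclideanSpace ℝ (Fin d) → ℝ := fun x => min 1 (max 0 ((1 - η - γ x) / η)) with hχ
  have hχone : ∀ x, γ x ≤ 1 - 2 * η → χ x = 1 := by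
    intro x hx
    have : 1 ≤ (1 - η - γ x) / η := by
      rw [le_div_iff₀ hη]
      linarith
    simp only [hχ]
    rw [max_eq_right (by linarith), min_eq_left this]
  have hχzero : ∀ x, 1 - η ≤ γ x → χ x = 0 := by
    intro x hx
    have : (1 - η - γ x) / η ≤ 0 := div_nonpos_of_nonpos_of_nonneg (by linarith) hη.le
    simp only [hχ]
    rw [max_eq_left this, min_eq_right zero_le_one]
  have hχ0 : ∀ x, 0 ≤ χ x := fun x => le_min zero_le_one (le_max_left _ _)
  have hχ1 : ∀ x, χ x ≤ 1 := fun x => min_le_left _ _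
  have hχmono : ∀ x y, γ y ≤ γ x → χ x ≤ χ y := by
    intro x y h
    simp only [hχ]
    gcongr
  have hsupp : tsupport χ ⊆ {x | γ x ≤ 1 - η} := by
    refine closure_minimal (fun x hx => ?_) (isClosed_le hγL.continuous continuous_const)
    by_contra hcon
    exact hx (hχzero x (le_of_lt (not_le.1 hcon)))
  have hsuppΩ : tsupport χ ⊆ Ω := fun x hx => by
    have h1 : γ x ≤ 1 - η := hsupp hx
    exact (hγlt x).1 (by linarith)
  refine ⟨χ, ?_, hχ0, hχ1, ?_, hsuppΩ, ?_, ?_⟩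
  · have h1 : LipschitzWith (K.toReal / η).toNNReal χ := by
      refine LipschitzWith.const_min (LipschitzWith.const_max ?_ 0) 1
      refine LipschitzWith.of_dist_le_mul fun x y => ?_
      have h2 := hγL.dist_le_mul x y
      rw [Real.coe_toNNReal _ (by positivity), Real.dist_eq]
      rw [Real.dist_eq] at h2
      have h3 : (1 - η - γ x) / η - (1 - η - γ y) / η = (-(γ x - γ y)) / η := by ring
      rw [h3, abs_div, abs_neg, abs_of_pos hη, div_mul_eq_mul_div]
      exact div_le_div_of_nonneg_right h2 hη.le
    refine h1.weaken (Real.toNNReal_le_toNNReal ?_)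
    refine div_le_div_of_nonneg_right ?_ hη.le
    have : 0 ≤ 2 * d * V := by positivity
    linarith
  · exact Metric.isCompact_of_isClosed_isBounded (isClosed_tsupport χ) (hb.subset hsuppΩ)
  · have h1 : {x ∈ Ω | χ x ≠ 1} ⊆ Ω \ AffineMap.homothety x₀ (1 - 2 * η) '' Ω := by
      rintro x ⟨hx, hx1⟩
      refine ⟨hx, ?_⟩
      rintro ⟨z, hz, rfl⟩
      apply hx1
      apply hχone
      rw [AffineMap.homothety_apply, vsub_eq_sub, vadd_eq_add, add_comm, hγhom _ _ (by linarith),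
        add_sub_cancel]
      have := (hγlt z).2 hz
      nlinarith
    refine (measureReal_mono h1 (measure_ne_top_of_subset sdiff_subset
      hb.measure_lt_top.ne)).trans ?_
    refine (measureReal_sdiff_homothety_le hΩ ho hb hx₀ (by linarith) (by linarith)).trans ?_
    have : d * (1 - (1 - 2 * η)) * V = 2 * d * V * η := by ring
    rw [← hV, this]
    gcongr
    have : (0 : ℝ) ≤ K := K.2
    linarith
  · intro x hd hne
    have hne1 : χ x ≠ 1 := by
      intro h
      apply hne
      refine IsLocalMax.fderiv_eq_zero (Eventually.of_forall fun y => ?_)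
      rw [h]
      exact hχ1 y
    have hne0 : χ x ≠ 0 := by
      intro h
      apply hne
      refine IsLocalMin.fderiv_eq_zero (Eventually.of_forall fun y => ?_)
      rw [h]
      exact hχ0 y
    have hg1 : 1 - 2 * η < γ x := by
      by_contra h
      exact hne1 (hχone x (not_lt.1 h))
    have hg2 : γ x < 1 - η := by
      by_contra h
      exact hne0 (hχzero x (not_lt.1 h))
    have hg0 : 0 < γ x := by linarith
    refine ⟨hne1, x₀ + (γ x)⁻¹ • (x - x₀), ?_, ?_, ?_⟩
    · apply hγfr
      rw [hγhom _ _ (inv_nonneg.2 hg0.le), add_sub_cancel, inv_mul_cancel₀ hg0.ne']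
    · have h1 : x - (x₀ + (γ x)⁻¹ • (x - x₀)) = (1 - (γ x)⁻¹) • (x - x₀) := by
        rw [sub_smul, one_smul]
        abel
      have h2 : ‖(1 - (γ x)⁻¹)‖ ≤ 4 * η := by
        rw [Real.norm_eq_abs, abs_sub_comm, abs_of_nonneg]
        · rw [sub_le_iff_le_add, inv_le_comm₀ hg0 (by linarith)]
          refine le_trans ?_ hg1.le
          rw [inv_le_iff_one_le_mul₀ (by linarith)]
          nlinarith
        · rw [sub_nonneg, one_le_inv₀ hg0]
          linarith
      rw [h1, norm_smul]
      calc ‖(1 - (γ x)⁻¹)‖ * ‖x - x₀‖ ≤ 4 * η * D := by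
            gcongr
            exact hD x ((hγlt x).1 (by linarith))
        _ = 4 * D * η := by ring
        _ ≤ C * η := by
            gcongr
            have : (0 : ℝ) ≤ K := K.2
            have : 0 ≤ 2 * d * V := by positivity
            linarith
    · set l := fderiv ℝ χ x with hl
      set n := (InnerProductSpace.toDual ℝ (EuclideanSpace ℝ (Fin d))).symm l with hn
      have hnl : ∀ w, inner ℝ n w = l w := fun w => by
        rw [hn, InnerProductSpace.toDual_symm_apply]
      have hnn : ‖n‖ = ‖l‖ := by rw [hn, LinearIsometryEquiv.norm_map]
      have hlpos : 0 < ‖l‖ := norm_pos_iff.2 hne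
      have hin : ∀ w, inner ℝ (-(‖l‖⁻¹ • n)) w = -(‖l‖⁻¹ * l w) := fun w => by
        rw [inner_neg_left, real_inner_smul_left, hnl]
      refine ⟨-(‖l‖⁻¹ • n), ⟨?_, fun z hz => ?_⟩, fun w => ?_⟩
      · rw [norm_neg, norm_smul, norm_inv, norm_norm, hnn, inv_mul_cancel₀ hlpos.ne']
      · rw [hin, neg_nonpos]
        refine mul_nonneg (inv_nonneg.2 hlpos.le) ?_
        have h1 : 0 ≤ l ((x₀ + γ x • (z - x₀)) - x) := by
          refine nonneg_fderiv_of_segment_le hd fun y hy => hχmono _ _ ?_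
          obtain ⟨a, b, ha, hb', hab, rfl⟩ := hy
          have h2 : a • x + b • (x₀ + γ x • (z - x₀)) - x₀
              = a • (x - x₀) + b • (γ x • (z - x₀)) := by
            obtain rfl : a = 1 - b := by linarith
            module
          have h3 : gauge S (z - x₀) < 1 := (hγlt z).2 hz
          calc γ (a • x + b • (x₀ + γ x • (z - x₀)))
              ≤ gauge S (a • (x - x₀)) + gauge S (b • (γ x • (z - x₀))) := by
                simp only [hγ]
                rw [h2]
                exact gauge_add_le hSc hSa _ _
            _ = a * γ x + b * (γ x * gauge S (z - x₀)) := by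
                rw [gauge_smul_of_nonneg ha, gauge_smul_of_nonneg hb',
                  gauge_smul_of_nonneg hg0.le]
                rfl
            _ ≤ a * γ x + b * (γ x * 1) := by gcongr
            _ = γ x := by rw [mul_one, ← add_mul, hab, one_mul]
        have h4 : (x₀ + γ x • (z - x₀)) - x = γ x • (z - (x₀ + (γ x)⁻¹ • (x - x₀))) := by
          rw [smul_sub (γ x) z (x₀ + _), smul_add, smul_inv_smul₀ hg0.ne']
          module
        rw [h4, map_smul, smul_eq_mul] at h1
        exact nonneg_of_mul_nonneg_right h1 hg0
      · rw [hin]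
        field_simp

end Cutoff

section Divergence

variable {d : ℕ} {Ω : Set (EuclideanSpace ℝ (Fin d))} {C η : ℝ}
  {χ : EuclideanSpace ℝ (Fin d) → ℝ} {Φ : EuclideanSpace ℝ (Fin d) → EuclideanSpace ℝ (Fin d)}

lemma IsBoundaryCutoff.eq_zero_of_notMem (hχ : IsBoundaryCutoff Ω C η χ)
    {x : EuclideanSpace ℝ (Fin d)} (hx : x ∉ Ω) : χ x = 0 :=
  image_eq_zero_of_notMem_tsupport fun h => hx (hχ.tsupport_subset h)

lemma continuousOn_divergence (ho : IsOpen Ω) (hΦ : ContDiffOn ℝ 1 Φ Ω) :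
    ContinuousOn (divergence Φ) Ω := by
  have h1 : ContinuousOn (fderiv ℝ Φ) Ω := hΦ.continuousOn_fderiv_of_isOpen ho le_rfl
  unfold divergence
  refine continuousOn_finsetSum _ fun i _ => ?_
  have h2 : ContinuousOn (fun x => fderiv ℝ Φ x (EuclideanSpace.single i 1)) Ω :=
    h1.clm_apply continuousOn_const
  exact (EuclideanSpace.proj (𝕜 := ℝ) i).continuous.comp_continuousOn h2

lemma IsBoundaryCutoff.integrable_mul (hχ : IsBoundaryCutoff Ω C η χ) (ho : IsOpen Ω)
    {g : EuclideanSpace ℝ (Fin d) → ℝ} (hg : ContinuousOn g Ω) :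
    Integrable (fun x => χ x * g x) := by
  have hs : tsupport (fun x => χ x * g x) ⊆ tsupport χ := tsupport_mul_subset_left
  have hc : Continuous (fun x => χ x * g x) :=
    (hχ.lipschitz.continuous.continuousOn.mul hg).continuous_of_tsupport_subset ho
      (hs.trans hχ.tsupport_subset)
  exact hc.integrable_of_hasCompactSupport hχ.hasCompactSupport.mul_right

lemma integral_cutoff_mul_divergence (hχ : IsBoundaryCutoff Ω C η χ) (ho : IsOpen Ω)
    (hΦ : ContDiffOn ℝ 1 Φ Ω) :
    ∫ x, χ x * divergence Φ x = -∫ x, fderiv ℝ χ x (Φ x) := by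
  obtain ⟨t, htc, hst, htΩ⟩ := exists_compact_between hχ.hasCompactSupport.isCompact ho
    hχ.tsupport_subset
  obtain ⟨θ, hθ1, hθ0, -⟩ := exists_contMDiffMap_one_nhds_of_subset_interior
    (modelWithCornersSelf ℝ (EuclideanSpace ℝ (Fin d))) (n := 1) (isClosed_tsupport χ) hst
  have hθs : ContDiff ℝ 1 θ := θ.contMDiff.contDiff
  set ψ : Fin d → EuclideanSpace ℝ (Fin d) → ℝ := fun i x => θ x * Φ x i with hψ
  have hψsupp : ∀ i, HasCompactSupport (ψ i) := fun i =>
    HasCompactSupport.intro htc fun x hx => by simp [hψ, hθ0 x hx]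
  have hψC : ∀ i, ContDiff ℝ 1 (ψ i) := by
    intro i
    rw [contDiff_iff_contDiffAt]
    intro x
    by_cases hx : x ∈ Ω
    · have h1 : ContDiffAt ℝ 1 Φ x := hΦ.contDiffAt (ho.mem_nhds hx)
      exact hθs.contDiffAt.mul
        ((EuclideanSpace.proj (𝕜 := ℝ) i).contDiff.contDiffAt.comp x h1)
    · have h1 : ψ i =ᶠ[𝓝 x] fun _ => 0 := by
        filter_upwards [htc.isClosed.isOpen_compl.mem_nhds (fun h => hx (htΩ h))] with y hy
        simp [hψ, hθ0 y hy]
      exact contDiffAt_const.congr_of_eventuallyEq h1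
  have hθnear : ∀ x ∈ tsupport χ, ∀ᶠ y in 𝓝 x, θ y = 1 := fun x hx =>
    hθ1.filter_mono (nhds_le_nhdsSet hx)
  have hleft : ∀ i x, lineDeriv ℝ (ψ i) x (EuclideanSpace.single i 1) * χ x =
      χ x * (fderiv ℝ Φ x (EuclideanSpace.single i 1)) i := by
    intro i x
    by_cases hx : x ∈ tsupport χ
    · have h1 : ψ i =ᶠ[𝓝 x] fun y => Φ y i := by
        filter_upwards [hθnear x hx] with y hy
        simp [hψ, hy]
      have hdΦ : HasFDerivAt Φ (fderiv ℝ Φ x) x :=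
        ((hΦ.contDiffAt (ho.mem_nhds (hχ.tsupport_subset hx))).differentiableAt
          one_ne_zero).hasFDerivAt
      have h2 : HasFDerivAt (fun y => Φ y i)
          ((EuclideanSpace.proj (𝕜 := ℝ) i).comp (fderiv ℝ Φ x)) x :=
        (EuclideanSpace.proj i : EuclideanSpace ℝ (Fin d) →L[ℝ] ℝ).hasFDerivAt.comp x hdΦ
      rw [h1.lineDeriv_eq, h2.differentiableAt.lineDeriv_eq_fderiv, h2.fderiv, mul_comm]
      rfl
    · rw [image_eq_zero_of_notMem_tsupport hx, mul_zero, zero_mul]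
  have hright : ∀ᵐ x, fderiv ℝ χ x (Φ x) =
      -∑ i, lineDeriv ℝ χ x (-EuclideanSpace.single i 1) * ψ i x := by
    filter_upwards [hχ.lipschitz.ae_differentiableAt] with x hdx
    by_cases hx : x ∈ tsupport χ
    · have h1 : θ x = 1 := (hθnear x hx).self_of_nhds
      have h2 : Φ x = ∑ i, Φ x i • EuclideanSpace.single i (1 : ℝ) := by
        have := (EuclideanSpace.basisFun (Fin d) ℝ).sum_repr (Φ x)
        simpa using this.symm
      conv_lhs => rw [h2]
      rw [map_sum, ← Finset.sum_neg_distrib]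
      refine Finset.sum_congr rfl fun i _ => ?_
      rw [hdx.lineDeriv_eq_fderiv, map_smul, map_neg, hψ]
      simp only [h1, smul_eq_mul]
      ring
    · rw [fderiv_of_notMem_tsupport ℝ hx]
      have : ∀ i, lineDeriv ℝ χ x (-EuclideanSpace.single i 1) = 0 := fun i => by
        rw [hdx.lineDeriv_eq_fderiv, fderiv_of_notMem_tsupport ℝ hx]
        rfl
      simp [this]
  rw [integral_congr_ae hright, integral_neg, neg_neg, integral_finsetSum]
  · have h1 : ∀ x, χ x * divergence Φ x =
        ∑ i, lineDeriv ℝ (ψ i) x (EuclideanSpace.single i 1) * χ x := by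
      intro x
      rw [divergence, Finset.mul_sum]
      exact Finset.sum_congr rfl fun i _ => (hleft i x).symm
    simp_rw [h1]
    rw [integral_finsetSum]
    · refine Finset.sum_congr rfl fun i _ => ?_
      obtain ⟨K, hK⟩ := ContDiff.lipschitzWith_of_hasCompactSupport (hψsupp i) (hψC i) one_ne_zero
      exact hK.integral_lineDeriv_mul_eq hχ.lipschitz hχ.hasCompactSupport _
    · intro i _
      simp_rw [hleft]
      refine hχ.integrable_mul ho ?_
      have h1 : ContinuousOn (fderiv ℝ Φ) Ω := hΦ.continuousOn_fderiv_of_isOpen ho le_rfl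
      have h2 : ContinuousOn (fun x => fderiv ℝ Φ x (EuclideanSpace.single i 1)) Ω :=
        h1.clm_apply continuousOn_const
      exact (EuclideanSpace.proj (𝕜 := ℝ) i).continuous.comp_continuousOn h2
  · intro i _
    exact Integrable.mul_of_top_right
      ((hψC i).continuous.integrable_of_hasCompactSupport (hψsupp i))
      (hχ.lipschitz.memLp_lineDeriv _)

lemma abs_integral_cutoff_mul_divergence_le (hχ : IsBoundaryCutoff Ω C η χ) (hC : 0 < C)
    (hη : 0 < η) (ho : IsOpen Ω) (hb : Bornology.IsBounded Ω) (hΦ : ContDiffOn ℝ 1 Φ Ω) {ω : ℝ}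
    (hω : 0 ≤ ω) (hΦω : ∀ x ∈ Ω, ∀ y ∈ frontier Ω, ‖x - y‖ ≤ C * η → ‖Φ x - Φ y‖ ≤ ω)
    (hn : ∀ x ∈ frontier Ω, ∀ ν, IsOutwardUnitNormal Ω x ν → inner ℝ (Φ x) ν = 0) :
    |∫ x, χ x * divergence Φ x| ≤ C ^ 2 * ω := by
  rw [integral_cutoff_mul_divergence hχ ho hΦ, abs_neg]
  set A := {x ∈ Ω | χ x ≠ 1} with hA
  have hAfin : volume A < ⊤ := (hb.subset (fun x hx => hx.1)).measure_lt_top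
  have key : ∀ x, DifferentiableAt ℝ χ x → fderiv ℝ χ x ≠ 0 →
      x ∈ A ∧ ‖fderiv ℝ χ x (Φ x)‖ ≤ C / η * ω := by
    intro x hdx hne
    have hx : x ∈ Ω := by
      by_contra h
      exact hne (fderiv_of_notMem_tsupport ℝ fun h' => h (hχ.tsupport_subset h'))
    obtain ⟨h1, y, hy, hxy, ν, hν, hw⟩ := hχ.normal x hdx hne
    refine ⟨⟨hx, h1⟩, ?_⟩
    have h2 : inner ℝ ν (Φ x) = inner ℝ ν (Φ x - Φ y) := by
      rw [inner_sub_right, real_inner_comm (Φ y) ν, hn y hy ν hν, sub_zero]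
    rw [hw, norm_neg, norm_mul, norm_norm, h2]
    have h3 : ‖fderiv ℝ χ x‖ ≤ C / η := by
      have := norm_fderiv_le_of_lipschitz ℝ hχ.lipschitz (x₀ := x)
      rwa [Real.coe_toNNReal _ (by positivity)] at this
    have h4 : ‖(inner ℝ ν (Φ x - Φ y) : ℝ)‖ ≤ ω := by
      refine (norm_inner_le_norm _ _).trans ?_
      rw [hν.1, one_mul]
      exact hΦω x hx y hy hxy
    gcongr
  have hz : ∀ x, x ∉ A → DifferentiableAt ℝ χ x → fderiv ℝ χ x (Φ x) = 0 := by
    intro x hx hdx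
    by_contra h
    refine hx (key x hdx ?_).1
    intro h0
    rw [h0] at h
    exact h rfl
  rw [← setIntegral_eq_integral_of_ae_compl_eq_zero (s := A)]
  · have h1 := norm_setIntegral_le_of_norm_le_const_ae' (μ := volume) (s := A) (C := C / η * ω)
      (f := fun x => fderiv ℝ χ x (Φ x)) hAfin (by
        filter_upwards [hχ.lipschitz.ae_differentiableAt] with x hdx _
        by_cases h0 : fderiv ℝ χ x = 0
        · rw [h0]
          simp only [zero_apply, norm_zero]
          positivity
        · exact (key x hdx h0).2)
    rw [Real.norm_eq_abs] at h1
    refine h1.trans ?_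
    calc C / η * ω * volume.real A ≤ C / η * ω * (C * η) := by
          gcongr
          exact hχ.measure_le
      _ = C ^ 2 * ω := by field_simp
  · filter_upwards [hχ.lipschitz.ae_differentiableAt] with x hdx hx using hz x hx hdx

end Divergence

section Transport

variable {d : ℕ} {Ω : Set (EuclideanSpace ℝ (Fin d))} {C η T c : ℝ}
  {χ : EuclideanSpace ℝ (Fin d) → ℝ} {G G' : ℝ → EuclideanSpace ℝ (Fin d) → ℝ}
  {Φ : ℝ → EuclideanSpace ℝ (Fin d) → EuclideanSpace ℝ (Fin d)}

lemma hasDerivAt_integral_cutoff_mul (hχ : IsBoundaryCutoff Ω C η χ) (ho : IsOpen Ω)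
    (hG : ContinuousOn (fun z : ℝ × EuclideanSpace ℝ (Fin d) => G z.1 z.2) (Ioo 0 T ×ˢ Ω))
    (hG' : ContinuousOn (fun z : ℝ × EuclideanSpace ℝ (Fin d) => G' z.1 z.2) (Ioo 0 T ×ˢ Ω))
    (hder : ∀ t ∈ Ioo 0 T, ∀ x ∈ Ω, HasDerivAt (fun s => G s x) (G' t x) t) {t : ℝ}
    (ht : t ∈ Ioo 0 T) :
    HasDerivAt (fun s => ∫ x, χ x * G s x) (∫ x, χ x * G' t x) t := by
  have hslice : ∀ {g : ℝ → EuclideanSpace ℝ (Fin d) → ℝ},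
      ContinuousOn (fun z : ℝ × EuclideanSpace ℝ (Fin d) => g z.1 z.2) (Ioo 0 T ×ˢ Ω) →
      ∀ s ∈ Ioo 0 T, ContinuousOn (g s) Ω := fun hg s hs =>
    hg.comp (f := fun x => (s, x)) (by fun_prop) (fun x hx => ⟨hs, hx⟩)
  obtain ⟨r, hr, hrs⟩ := Metric.nhds_basis_closedBall.mem_iff.1 (isOpen_Ioo.mem_nhds ht)
  have hK : IsCompact (Metric.closedBall t r ×ˢ tsupport χ) :=
    (isCompact_closedBall t r).prod hχ.hasCompactSupport.isCompact
  obtain ⟨B, hB⟩ := hK.exists_bound_of_continuousOn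
    (hG'.mono (prod_mono hrs hχ.tsupport_subset))
  refine (hasDerivAt_integral_of_dominated_loc_of_deriv_le (F' := fun s x => χ x * G' s x)
    (bound := fun x => χ x * |B|) (Metric.closedBall_mem_nhds t hr) ?_ ?_ ?_ ?_ ?_ ?_).2
  · filter_upwards [isOpen_Ioo.mem_nhds ht] with s hs
    exact (hχ.integrable_mul ho (hslice hG s hs)).aestronglyMeasurable
  · exact hχ.integrable_mul ho (hslice hG t ht)
  · exact (hχ.integrable_mul ho (hslice hG' t ht)).aestronglyMeasurable
  · refine Eventually.of_forall fun x s hs => ?_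
    rw [norm_mul, Real.norm_of_nonneg (hχ.nonneg x)]
    by_cases hx : x ∈ tsupport χ
    · exact mul_le_mul_of_nonneg_left ((hB (s, x) ⟨hs, hx⟩).trans (le_abs_self B)) (hχ.nonneg x)
    · rw [image_eq_zero_of_notMem_tsupport hx, zero_mul, zero_mul]
  · exact hχ.integrable_mul ho continuousOn_const
  · refine Eventually.of_forall fun x s hs => ?_
    by_cases hx : x ∈ tsupport χ
    · exact (hder s (hrs hs) x (hχ.tsupport_subset hx)).const_mul _
    · simp only [image_eq_zero_of_notMem_tsupport hx, zero_mul]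
      exact hasDerivAt_const _ _

lemma abs_setIntegral_sub_cutoff_le (hχ : IsBoundaryCutoff Ω C η χ) (ho : IsOpen Ω)
    (hb : Bornology.IsBounded Ω) {g : EuclideanSpace ℝ (Fin d) → ℝ} (hg : ContinuousOn g Ω)
    {B : ℝ} (hB0 : 0 ≤ B) (hB : ∀ x ∈ Ω, |g x| ≤ B) :
    |(∫ x in Ω, g x) - ∫ x, χ x * g x| ≤ B * (C * η) := by
  have hint : IntegrableOn g Ω := by
    have : IsFiniteMeasure (volume.restrict Ω) := ⟨by simpa using hb.measure_lt_top⟩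
    refine Integrable.of_bound (hg.aestronglyMeasurable ho.measurableSet) B ?_
    filter_upwards [ae_restrict_mem ho.measurableSet] with x hx using hB x hx
  have h1 : ∫ x, χ x * g x = ∫ x in Ω, χ x * g x :=
    (setIntegral_eq_integral_of_forall_compl_eq_zero fun x hx => by
      rw [hχ.eq_zero_of_notMem hx, zero_mul]).symm
  rw [h1, ← integral_sub hint (hχ.integrable_mul ho hg).integrableOn]
  set A := {x ∈ Ω | χ x ≠ 1} with hA
  have hAΩ : A ⊆ Ω := fun x hx => hx.1
  have hAm : MeasurableSet A :=
    ho.measurableSet.inter (hχ.lipschitz.continuous.measurable (measurableSet_singleton 1).compl)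
  have h2 : ∫ x in Ω, (g x - χ x * g x) = ∫ x in A, (g x - χ x * g x) := by
    refine setIntegral_eq_of_subset_of_forall_sdiff_eq_zero ho.measurableSet hAΩ fun x hx => ?_
    have : χ x = 1 := by
      by_contra h
      exact hx.2 ⟨hx.1, h⟩
    rw [this, one_mul, sub_self]
  rw [h2, ← Real.norm_eq_abs]
  refine (norm_setIntegral_le_of_norm_le_const (C := B) ((measure_mono hAΩ).trans_lt
    hb.measure_lt_top) fun x hx => ?_).trans ?_
  · have h3 : g x - χ x * g x = (1 - χ x) * g x := by ring
    rw [h3, norm_mul, Real.norm_of_nonneg (sub_nonneg.2 (hχ.le_one x))]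
    calc (1 - χ x) * ‖g x‖ ≤ 1 * B := by
          refine mul_le_mul (by linarith [hχ.nonneg x]) (hB x hx.1) (norm_nonneg _) zero_le_one
      _ = B := one_mul B
  · exact mul_le_mul_of_nonneg_left hχ.measure_le hB0

/-- If `∂ₜ G - div Φ ≤ c` inside the cylinder and `Φ` is tangent to its lateral boundary, then the
integral of `G` over `Ω` grows at most at the rate `c |Ω|`. -/
theorem setIntegral_sub_le_of_transport (hΩ : Convex ℝ Ω) (ho : IsOpen Ω)
    (hb : Bornology.IsBounded Ω) (hne : Ω.Nonempty) (hT : 0 < T) (hc : 0 ≤ c)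
    (hG : ContinuousOn (fun z : ℝ × EuclideanSpace ℝ (Fin d) => G z.1 z.2)
      (Icc 0 T ×ˢ closure Ω))
    (hG' : ContinuousOn (fun z : ℝ × EuclideanSpace ℝ (Fin d) => G' z.1 z.2) (Ioo 0 T ×ˢ Ω))
    (hder : ∀ t ∈ Ioo 0 T, ∀ x ∈ Ω, HasDerivAt (fun s => G s x) (G' t x) t)
    (hΦ : ContinuousOn (fun z : ℝ × EuclideanSpace ℝ (Fin d) => Φ z.1 z.2)
      (Icc 0 T ×ˢ closure Ω))
    (hΦ1 : ∀ t ∈ Ioo 0 T, ContDiffOn ℝ 1 (Φ t) Ω)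
    (hn : ∀ t ∈ Ioo 0 T, ∀ x ∈ frontier Ω, ∀ ν, IsOutwardUnitNormal Ω x ν →
      inner ℝ (Φ t x) ν = 0)
    (hle : ∀ t ∈ Ioo 0 T, ∀ x ∈ Ω, G' t x - divergence (Φ t) x ≤ c) :
    (∫ x in Ω, G T x) - ∫ x in Ω, G 0 x ≤ c * T * volume.real Ω := by
  obtain ⟨C, hC, hcut⟩ := exists_boundaryCutoff hΩ ho hb hne
  have hcpt : IsCompact (Icc 0 T ×ˢ closure Ω) := isCompact_Icc.prod hb.isCompact_closure
  obtain ⟨B, hB⟩ := hcpt.exists_bound_of_continuousOn hG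
  have hB0 : 0 ≤ B := by
    obtain ⟨x, hx⟩ := hne
    exact (norm_nonneg _).trans (hB (0, x) ⟨⟨le_rfl, hT.le⟩, subset_closure hx⟩)
  have hunif := hcpt.uniformContinuousOn_of_continuous hΦ
  rw [Metric.uniformContinuousOn_iff] at hunif
  have hGsl : ∀ s ∈ Icc 0 T, ContinuousOn (G s) Ω := fun s hs =>
    hG.comp (f := fun x => (s, x)) (by fun_prop) (fun x hx => ⟨hs, subset_closure hx⟩)
  have key : ∀ ω : ℝ, 0 < ω → (∫ x in Ω, G T x) - ∫ x in Ω, G 0 x ≤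
      c * T * volume.real Ω + ω * (C ^ 2 * T + 2 * B * C) := by
    intro ω hω
    obtain ⟨τ, hτ, hτω⟩ := hunif ω hω
    set η := min (1 / 4) (min ω (τ / (2 * C))) with hη
    have hη0 : 0 < η := by positivity
    have hη1 : η ≤ 1 / 4 := min_le_left _ _
    have hηω : η ≤ ω := (min_le_right _ _).trans (min_le_left _ _)
    have hητ : C * η < τ := by
      have h1 : η ≤ τ / (2 * C) := (min_le_right _ _).trans (min_le_right _ _)
      calc C * η ≤ C * (τ / (2 * C)) := by gcongr
        _ = τ / 2 := by field_simp
        _ < τ := by linarith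
    obtain ⟨χ, hχ⟩ := hcut η hη0 hη1
    set Y : ℝ → ℝ := fun s => ∫ x, χ x * G s x with hY
    have hYd : ∀ t ∈ Ioo 0 T, HasDerivAt Y (∫ x, χ x * G' t x) t := fun t ht =>
      hasDerivAt_integral_cutoff_mul hχ ho (hG.mono (prod_mono Ioo_subset_Icc_self subset_closure))
        hG' hder ht
    have hYc : ContinuousOn Y (Icc 0 T) := by
      intro t ht
      refine continuousWithinAt_of_dominated (bound := fun x => χ x * B) ?_ ?_ ?_ ?_
      · filter_upwards [self_mem_nhdsWithin] with s hs
        exact (hχ.integrable_mul ho (hGsl s hs)).aestronglyMeasurable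
      · filter_upwards [self_mem_nhdsWithin] with s hs
        refine Eventually.of_forall fun x => ?_
        rw [norm_mul, Real.norm_of_nonneg (hχ.nonneg x)]
        by_cases hx : x ∈ Ω
        · exact mul_le_mul_of_nonneg_left (hB (s, x) ⟨hs, subset_closure hx⟩) (hχ.nonneg x)
        · rw [hχ.eq_zero_of_notMem hx, zero_mul, zero_mul]
      · exact hχ.integrable_mul ho continuousOn_const
      · refine Eventually.of_forall fun x => ?_
        by_cases hx : x ∈ Ω
        · have : ContinuousOn (fun s => G s x) (Icc 0 T) :=
            hG.comp (f := fun s => (s, x)) (by fun_prop) (fun s hs => ⟨hs, subset_closure hx⟩)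
          exact continuousWithinAt_const.mul (this t ht)
        · simp only [hχ.eq_zero_of_notMem hx, zero_mul]
          exact continuousWithinAt_const
    have hYle : ∀ t ∈ Ioo 0 T, ∫ x, χ x * G' t x ≤ C ^ 2 * ω + c * volume.real Ω := by
      intro t ht
      have hG't : ContinuousOn (G' t) Ω :=
        hG'.comp (f := fun x => (t, x)) (by fun_prop) (fun x hx => ⟨ht, hx⟩)
      have hdiv := continuousOn_divergence ho (hΦ1 t ht)
      have h1 : ∫ x, χ x * G' t x ≤ ∫ x, (χ x * divergence (Φ t) x + χ x * c) := by
        refine integral_mono (hχ.integrable_mul ho hG't)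
          ((hχ.integrable_mul ho hdiv).add (hχ.integrable_mul ho continuousOn_const)) fun x => ?_
        by_cases hx : x ∈ Ω
        · have := mul_le_mul_of_nonneg_left (hle t ht x hx) (hχ.nonneg x)
          simp only
          linarith
        · simp [hχ.eq_zero_of_notMem hx]
      rw [integral_add (hχ.integrable_mul ho hdiv) (hχ.integrable_mul ho continuousOn_const)] at h1
      have h2 : |∫ x, χ x * divergence (Φ t) x| ≤ C ^ 2 * ω := by
        refine abs_integral_cutoff_mul_divergence_le hχ hC hη0 ho hb (hΦ1 t ht) hω.le ?_ (hn t ht)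
        intro x hx y hy hxy
        have := hτω (t, x) ⟨Ioo_subset_Icc_self ht, subset_closure hx⟩ (t, y)
          ⟨Ioo_subset_Icc_self ht, frontier_subset_closure hy⟩ (by
            rw [Prod.dist_eq, dist_self, dist_eq_norm, max_eq_right (norm_nonneg _)]
            exact hxy.trans_lt hητ)
        rw [dist_eq_norm] at this
        exact this.le
      have h3 : ∫ x, χ x * c ≤ c * volume.real Ω := by
        rw [← setIntegral_eq_integral_of_forall_compl_eq_zero (s := Ω) fun x hx => by
          rw [hχ.eq_zero_of_notMem hx, zero_mul]]
        have h4 : ∫ x in Ω, χ x * c ≤ ∫ _x in Ω, c := by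
          refine integral_mono (hχ.integrable_mul ho continuousOn_const).integrableOn
            (integrableOn_const hb.measure_lt_top.ne) fun x => ?_
          exact mul_le_of_le_one_left hc (hχ.le_one x)
        rw [setIntegral_const, smul_eq_mul] at h4
        linarith
      linarith [le_abs_self (∫ x, χ x * divergence (Φ t) x)]
    have hmv : Y T - Y 0 ≤ (C ^ 2 * ω + c * volume.real Ω) * (T - 0) := by
      refine (convex_Icc 0 T).image_sub_le_mul_sub_of_deriv_le hYc ?_ ?_ 0 ⟨le_rfl, hT.le⟩ T
        ⟨hT.le, le_rfl⟩ hT.le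
      · rw [interior_Icc]
        exact fun t ht => (hYd t ht).differentiableAt.differentiableWithinAt
      · rw [interior_Icc]
        intro t ht
        rw [(hYd t ht).deriv]
        exact hYle t ht
    have hE : ∀ s ∈ Icc 0 T, |(∫ x in Ω, G s x) - Y s| ≤ B * (C * η) := fun s hs =>
      abs_setIntegral_sub_cutoff_le hχ ho hb (hGsl s hs) hB0 fun x hx =>
        hB (s, x) ⟨hs, subset_closure hx⟩
    have e1 := (abs_le.1 (hE T ⟨hT.le, le_rfl⟩)).2
    have e0 := (abs_le.1 (hE 0 ⟨le_rfl, hT.le⟩)).1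
    have e2 : B * (C * η) ≤ B * (C * ω) := by gcongr
    nlinarith
  refine le_of_forall_pos_le_add fun e he => ?_
  have hM : 0 < C ^ 2 * T + 2 * B * C + 1 := by positivity
  refine (key (e / (C ^ 2 * T + 2 * B * C + 1)) (by positivity)).trans ?_
  gcongr
  rw [div_mul_eq_mul_div, div_le_iff₀ hM]
  nlinarith

end Transport

section Gradient

variable {d : ℕ}

lemma inner_gradient (g : EuclideanSpace ℝ (Fin d) → ℝ) (x w : EuclideanSpace ℝ (Fin d)) :
    inner ℝ (gradient g x) w = fderiv ℝ g x w := by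
  rw [gradient, InnerProductSpace.toDual_symm_apply]

lemma contDiffOn_gradient {s : Set (EuclideanSpace ℝ (Fin d))} (hs : IsOpen s)
    {g : EuclideanSpace ℝ (Fin d) → ℝ} (hg : ContDiffOn ℝ 2 g s) :
    ContDiffOn ℝ 1 (gradient g) s :=
  (InnerProductSpace.toDual ℝ (EuclideanSpace ℝ (Fin d))).symm.toContinuousLinearEquiv.contDiff
    |>.comp_contDiffOn (hg.fderiv_of_isOpen hs (by norm_num))

lemma divergence_smul {κ : EuclideanSpace ℝ (Fin d) → ℝ}
    {F : EuclideanSpace ℝ (Fin d) → EuclideanSpace ℝ (Fin d)} {x : EuclideanSpace ℝ (Fin d)}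
    (hκ : DifferentiableAt ℝ κ x) (hF : DifferentiableAt ℝ F x) :
    divergence (fun y => κ y • F y) x = κ x * divergence F x + fderiv ℝ κ x (F x) := by
  have h2 : F x = ∑ i, F x i • EuclideanSpace.single i (1 : ℝ) := by
    have := (EuclideanSpace.basisFun (Fin d) ℝ).sum_repr (F x)
    simpa using this.symm
  have h3 : fderiv ℝ κ x (F x) = ∑ i, F x i * fderiv ℝ κ x (EuclideanSpace.single i 1) := by
    conv_lhs => rw [h2]
    simp
  rw [h3]
  unfold divergence
  rw [Finset.mul_sum, ← Finset.sum_add_distrib, fderiv_fun_smul hκ hF]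
  refine Finset.sum_congr rfl fun i _ => ?_
  simp [mul_comm]

end Gradient

section Regularity

variable {d : ℕ} {Ω : Set (EuclideanSpace ℝ (Fin d))} {T q ε : ℝ}
  {H : EuclideanSpace ℝ (Fin d) → ℝ} {f : ℝ → ℝ} {V : EuclideanSpace ℝ (Fin d) → ℝ}
  {u m : ℝ → EuclideanSpace ℝ (Fin d) → ℝ}

lemma hasFDerivAt_slices {g : ℝ → EuclideanSpace ℝ (Fin d) → ℝ} (ho : IsOpen Ω)
    (hg : ContDiffOn ℝ 1 (fun z : ℝ × EuclideanSpace ℝ (Fin d) => g z.1 z.2) (Ioo 0 T ×ˢ Ω))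
    {t : ℝ} (ht : t ∈ Ioo 0 T) {x : EuclideanSpace ℝ (Fin d)} (hx : x ∈ Ω) :
    ∃ L : ℝ × EuclideanSpace ℝ (Fin d) →L[ℝ] ℝ,
      HasFDerivAt (fun z : ℝ × EuclideanSpace ℝ (Fin d) => g z.1 z.2) L (t, x) ∧
      L = fderiv ℝ (fun z : ℝ × EuclideanSpace ℝ (Fin d) => g z.1 z.2) (t, x) ∧
      HasDerivAt (fun s => g s x) (L (1, 0)) t ∧
      HasFDerivAt (g t) (L.comp (ContinuousLinearMap.inr ℝ ℝ (EuclideanSpace ℝ (Fin d)))) x := by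
  have h1 : HasFDerivAt (fun z : ℝ × EuclideanSpace ℝ (Fin d) => g z.1 z.2)
      (fderiv ℝ (fun z : ℝ × EuclideanSpace ℝ (Fin d) => g z.1 z.2) (t, x)) (t, x) :=
    ((hg.contDiffAt ((isOpen_Ioo.prod ho).mem_nhds ⟨ht, hx⟩)).differentiableAt
      one_ne_zero).hasFDerivAt
  refine ⟨_, h1, rfl, ?_, ?_⟩
  · have h2 : HasDerivAt (fun s : ℝ => (s, x)) (1, 0) t :=
      (hasDerivAt_id t).prodMk (hasDerivAt_const t x)
    exact h1.comp_hasDerivAt t h2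
  · have h2 : HasFDerivAt (fun y : EuclideanSpace ℝ (Fin d) => (t, y))
        (ContinuousLinearMap.inr ℝ ℝ (EuclideanSpace ℝ (Fin d))) x := hasFDerivAt_prodMk_right t x
    exact h1.comp x h2

lemma continuousOn_deriv_time {g : ℝ → EuclideanSpace ℝ (Fin d) → ℝ} (ho : IsOpen Ω)
    (hg : ContDiffOn ℝ 1 (fun z : ℝ × EuclideanSpace ℝ (Fin d) => g z.1 z.2) (Ioo 0 T ×ˢ Ω)) :
    ContinuousOn (fun z : ℝ × EuclideanSpace ℝ (Fin d) => deriv (fun s => g s z.2) z.1)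
      (Ioo 0 T ×ˢ Ω) := by
  have h1 := hg.continuousOn_fderiv_of_isOpen (isOpen_Ioo.prod ho) le_rfl
  refine (h1.clm_apply (continuousOn_const (c := ((1 : ℝ), (0 : EuclideanSpace ℝ (Fin d)))))).congr
    fun z hz => ?_
  obtain ⟨L, -, rfl, h2, -⟩ := hasFDerivAt_slices ho hg hz.1 hz.2
  exact h2.deriv

lemma continuousOn_gradientWithin (hΩ : Convex ℝ Ω) (ho : IsOpen Ω) (hne : Ω.Nonempty)
    (hT : 0 < T) {g : ℝ → EuclideanSpace ℝ (Fin d) → ℝ}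
    (hg : ContDiffOn ℝ 1 (fun z : ℝ × EuclideanSpace ℝ (Fin d) => g z.1 z.2)
      (Icc 0 T ×ˢ closure Ω)) :
    ContinuousOn (fun z : ℝ × EuclideanSpace ℝ (Fin d) =>
      gradientWithin (g z.1) (closure Ω) z.2) (Icc 0 T ×ˢ closure Ω) := by
  have huc : UniqueDiffOn ℝ (closure Ω) := uniqueDiffOn_convex hΩ.closure
    (hne.mono (interior_maximal subset_closure ho))
  have hud : UniqueDiffOn ℝ (Icc 0 T ×ˢ closure Ω) := (uniqueDiffOn_Icc hT).prod huc
  have h1 := hg.continuousOn_fderivWithin hud le_rfl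
  have h2 : ContinuousOn (fun z : ℝ × EuclideanSpace ℝ (Fin d) =>
      (InnerProductSpace.toDual ℝ (EuclideanSpace ℝ (Fin d))).symm
        ((fderivWithin ℝ (fun z : ℝ × EuclideanSpace ℝ (Fin d) => g z.1 z.2)
          (Icc 0 T ×ˢ closure Ω) z).comp (ContinuousLinearMap.inr ℝ ℝ (EuclideanSpace ℝ (Fin d)))))
      (Icc 0 T ×ˢ closure Ω) :=
    (LinearIsometryEquiv.continuous _).comp_continuousOn (h1.clm_comp continuousOn_const)
  refine h2.congr fun z hz => ?_
  have h3 : HasFDerivWithinAt (fun y : EuclideanSpace ℝ (Fin d) => (z.1, y))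
      (ContinuousLinearMap.inr ℝ ℝ (EuclideanSpace ℝ (Fin d))) (closure Ω) z.2 :=
    (hasFDerivAt_prodMk_right z.1 z.2).hasFDerivWithinAt
  have h4 := ((hg.differentiableOn one_ne_zero) z hz).hasFDerivWithinAt
  have h5 : HasFDerivWithinAt (g z.1) _ (closure Ω) z.2 :=
    HasFDerivWithinAt.comp (f := fun y : EuclideanSpace ℝ (Fin d) => (z.1, y))
      (g := fun z : ℝ × EuclideanSpace ℝ (Fin d) => g z.1 z.2) z.2 h4 h3
      (fun y hy => ⟨hz.1, hy⟩)
  simp only [gradientWithin]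
  rw [h5.fderivWithin (huc z.2 hz.2)]

lemma gradientWithin_closure_eq (ho : IsOpen Ω) (g : EuclideanSpace ℝ (Fin d) → ℝ)
    {x : EuclideanSpace ℝ (Fin d)} (hx : x ∈ Ω) :
    gradientWithin g (closure Ω) x = gradient g x := by
  rw [gradientWithin, gradient,
    fderivWithin_of_mem_nhds (mem_of_superset (ho.mem_nhds hx) subset_closure)]

lemma contDiffOn_slice {n : WithTop ℕ∞} {g : ℝ → EuclideanSpace ℝ (Fin d) → ℝ}
    (hg : ContDiffOn ℝ n (fun z : ℝ × EuclideanSpace ℝ (Fin d) => g z.1 z.2) (Ioo 0 T ×ˢ Ω))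
    {t : ℝ} (ht : t ∈ Ioo 0 T) : ContDiffOn ℝ n (g t) Ω :=
  hg.comp (g := fun z : ℝ × EuclideanSpace ℝ (Fin d) => g z.1 z.2)
    (f := fun y => (t, y)) (contDiff_prodMk_right t).contDiffOn (fun _ hy => ⟨ht, hy⟩)

lemma _root_.IsClassicalPair.u_continuousOn (hs : IsClassicalPair Ω T H f ε V u m) {t : ℝ}
    (ht : t ∈ Icc 0 T) : ContinuousOn (u t) (closure Ω) :=
  hs.u_C1.continuousOn.comp (f := fun x => (t, x)) (by fun_prop) (fun _ hx => ⟨ht, hx⟩)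

lemma _root_.IsClassicalPair.m_continuousOn (hs : IsClassicalPair Ω T H f ε V u m) {t : ℝ}
    (ht : t ∈ Icc 0 T) : ContinuousOn (m t) (closure Ω) :=
  hs.m_C0.comp (f := fun x => (t, x)) (by fun_prop) (fun _ hx => ⟨ht, hx⟩)

/-- The continuity equation tested with a function of `u - a t - b`. -/
theorem _root_.IsClassicalPair.setIntegral_sub_le (hs : IsClassicalPair Ω T H f ε V u m)
    (hH : ContDiff ℝ 2 H) (hΩ : Convex ℝ Ω) (ho : IsOpen Ω)
    (hb : Bornology.IsBounded Ω) (hne : Ω.Nonempty) (hT : 0 < T) {k k' : ℝ → ℝ}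
    (hk : ∀ r, HasDerivAt k (k' r) r) (hk' : Continuous k') (a b : ℝ)
    {μ : EuclideanSpace ℝ (Fin d) → ℝ} (hμ : ContinuousOn μ (closure Ω)) {c : ℝ} (hc : 0 ≤ c)
    (hle : ∀ t ∈ Ioo 0 T, ∀ x ∈ Ω, k' (u t x - a * t - b) *
      ((deriv (fun s => u s x) t - a) * (m t x - μ x) -
        m t x * fderiv ℝ H (gradient (u t) x) (gradient (u t) x)) ≤ c) :
    (∫ x in Ω, k (u T x - a * T - b) * (m T x - μ x)) -
      ∫ x in Ω, k (u 0 x - a * 0 - b) * (m 0 x - μ x) ≤ c * T * volume.real Ω := by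
  have hkC : ContDiff ℝ 1 k := by
    rw [contDiff_one_iff_deriv]
    refine ⟨fun r => (hk r).differentiableAt, ?_⟩
    have : deriv k = k' := funext fun r => (hk r).deriv
    rwa [this]
  have hkc : Continuous k := hkC.continuous
  have hu1 := hs.u_C2.of_le (show (1 : WithTop ℕ∞) ≤ 2 by norm_num)
  have hsub : Ioo 0 T ×ˢ Ω ⊆ Icc 0 T ×ˢ closure Ω := prod_mono Ioo_subset_Icc_self subset_closure
  have hgH : ContDiff ℝ 1 (gradient H) :=
    contDiffOn_univ.1 (contDiffOn_gradient isOpen_univ hH.contDiffOn)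
  have hμ2 : ContinuousOn (fun z : ℝ × EuclideanSpace ℝ (Fin d) => μ z.2)
      (Icc 0 T ×ˢ closure Ω) := hμ.comp continuousOn_snd (fun z hz => hz.2)
  have hw : ContinuousOn (fun z : ℝ × EuclideanSpace ℝ (Fin d) => u z.1 z.2 - a * z.1 - b)
      (Icc 0 T ×ˢ closure Ω) := (hs.u_C1.continuousOn.sub (by fun_prop)).sub (by fun_prop)
  have hG1 := hkc.comp_continuousOn hw
  have hΦeq : ∀ t, ∀ x ∈ Ω,
      k (u t x - a * t - b) • m t x • gradient H (gradientWithin (u t) (closure Ω) x) =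
      k (u t x - a * t - b) • m t x • gradient H (gradient (u t) x) := fun t x hx => by
    rw [gradientWithin_closure_eq ho _ hx]
  have hκ : ∀ t ∈ Ioo 0 T, ContDiffOn ℝ 1 (fun x => k (u t x - a * t - b)) Ω := fun t ht =>
    hkC.comp_contDiffOn (((contDiffOn_slice hu1 ht).sub contDiffOn_const).sub contDiffOn_const)
  have hF : ∀ t ∈ Ioo 0 T, ContDiffOn ℝ 1 (fun x => m t x • gradient H (gradient (u t) x)) Ω :=
    fun t ht => (contDiffOn_slice hs.m_C1 ht).smul
      (hgH.comp_contDiffOn (contDiffOn_gradient ho (contDiffOn_slice hs.u_C2 ht)))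
  refine setIntegral_sub_le_of_transport
    (G := fun t x => k (u t x - a * t - b) * (m t x - μ x))
    (G' := fun t x => k' (u t x - a * t - b) * (deriv (fun s => u s x) t - a) * (m t x - μ x) +
      k (u t x - a * t - b) * deriv (fun s => m s x) t)
    (Φ := fun t x => k (u t x - a * t - b) • m t x •
      gradient H (gradientWithin (u t) (closure Ω) x))
    hΩ ho hb hne hT hc ?_ ?_ ?_ ?_ ?_ ?_ ?_
  · exact hG1.mul (hs.m_C0.sub hμ2)
  · exact (((hk'.comp_continuousOn (hw.mono hsub)).mul
      ((continuousOn_deriv_time ho hu1).sub continuousOn_const)).mul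
      ((hs.m_C0.sub hμ2).mono hsub)).add
      ((hG1.mono hsub).mul (continuousOn_deriv_time ho hs.m_C1))
  · intro t ht x hx
    obtain ⟨L, -, -, hL, -⟩ := hasFDerivAt_slices ho hu1 ht hx
    obtain ⟨M, -, -, hM, -⟩ := hasFDerivAt_slices ho hs.m_C1 ht hx
    rw [hL.deriv, hM.deriv]
    have h1 : HasDerivAt (fun s => u s x - a * s - b) (L (1, 0) - a) t := by
      simpa using (hL.sub ((hasDerivAt_id t).const_mul a)).sub_const b
    exact ((hk _).comp t h1).mul (hM.sub_const (μ x))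
  · exact hG1.smul (hs.m_C0.smul (hgH.continuous.comp_continuousOn
      (continuousOn_gradientWithin hΩ ho hne hT hs.u_C1)))
  · intro t ht
    exact ((hκ t ht).smul (hF t ht)).congr (hΦeq t)
  · intro t ht x hx ν hν
    rw [real_inner_smul_left, real_inner_smul_left, hs.neumann t ht x hx ν hν, mul_zero, mul_zero]
  · intro t ht x hx
    have e1 : divergence (fun x => k (u t x - a * t - b) • m t x •
        gradient H (gradientWithin (u t) (closure Ω) x)) x =
        divergence (fun x => k (u t x - a * t - b) • m t x • gradient H (gradient (u t) x)) x := by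
      have : (fun x => k (u t x - a * t - b) • m t x •
          gradient H (gradientWithin (u t) (closure Ω) x)) =ᶠ[𝓝 x]
          (fun x => k (u t x - a * t - b) • m t x • gradient H (gradient (u t) x)) := by
        filter_upwards [ho.mem_nhds hx] with y hy using hΦeq t y hy
      unfold divergence
      rw [this.fderiv_eq]
    have hxn := ho.mem_nhds hx
    have e2 := divergence_smul (((hκ t ht).contDiffAt hxn).differentiableAt one_ne_zero)
      (((hF t ht).contDiffAt hxn).differentiableAt one_ne_zero)
    have hut : DifferentiableAt ℝ (u t) x :=
      ((contDiffOn_slice hu1 ht).contDiffAt hxn).differentiableAt one_ne_zero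
    have e3 : fderiv ℝ (fun x => k (u t x - a * t - b)) x =
        k' (u t x - a * t - b) • fderiv ℝ (u t) x := by
      have h1 : HasFDerivAt (fun y => u t y - a * t - b) (fderiv ℝ (u t) x) x :=
        (hut.hasFDerivAt.sub_const (a * t)).sub_const b
      exact ((hk _).comp_hasFDerivAt x h1).fderiv
    have e4 : fderiv ℝ (u t) x (gradient H (gradient (u t) x)) =
        fderiv ℝ H (gradient (u t) x) (gradient (u t) x) := by
      rw [← inner_gradient, ← inner_gradient, real_inner_comm]
    have e5 := hs.continuity t ht x hx
    have e6 := hle t ht x hx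
    rw [e1, e2, e3]
    simp only [smul_apply, map_smul, smul_eq_mul, e4]
    rw [← sub_eq_zero.1 e5]
    linarith

end Regularity

section HamiltonJacobi

variable {d : ℕ} {Ω : Set (EuclideanSpace ℝ (Fin d))} {T q ε : ℝ}
  {H : EuclideanSpace ℝ (Fin d) → ℝ} {f : ℝ → ℝ} {V : EuclideanSpace ℝ (Fin d) → ℝ}
  {u m : ℝ → EuclideanSpace ℝ (Fin d) → ℝ}

lemma _root_.IsClassicalPair.le_along_segment (hs : IsClassicalPair Ω T H f ε V u m)
    (hΩ : Convex ℝ Ω) (ho : IsOpen Ω) {A r K : ℝ}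
    (hA : ∀ p v : EuclideanSpace ℝ (Fin d), -(A * (1 + ‖v‖) ^ r) ≤ H p + inner ℝ p v)
    (hK : ∀ t ∈ Ioo 0 T, ∀ x ∈ Ω, fEps f ε (m t x) + V x ≤ K) {t₁ t₂ : ℝ} (h1 : 0 ≤ t₁)
    (h12 : t₁ < t₂) (h2 : t₂ ≤ T) {x y : EuclideanSpace ℝ (Fin d)} (hx : x ∈ Ω) (hy : y ∈ Ω) :
    u t₁ x ≤ u t₂ y + (t₂ - t₁) * (K + A * (1 + ‖y - x‖ / (t₂ - t₁)) ^ r) := by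
  have hτ : 0 < t₂ - t₁ := sub_pos.2 h12
  set v := (t₂ - t₁)⁻¹ • (y - x) with hv
  set γ : ℝ → EuclideanSpace ℝ (Fin d) := fun s => x + (s - t₁) • v with hγ
  have hγΩ : ∀ s ∈ Icc t₁ t₂, γ s ∈ Ω := by
    intro s hs
    have := hΩ.add_smul_sub_mem hx hy (t := (s - t₁) / (t₂ - t₁))
      ⟨div_nonneg (by linarith [hs.1]) hτ.le, (div_le_one hτ).2 (by linarith [hs.2])⟩
    rwa [div_eq_mul_inv, mul_smul] at this
  have hγd : ∀ s, HasDerivAt γ v s := fun s => by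
    simpa [hγ] using (((hasDerivAt_id s).sub_const t₁).smul_const v).const_add x
  have hγc : Continuous γ := continuous_iff_continuousAt.2 fun s => (hγd s).continuousAt
  have hv' : ‖v‖ = ‖y - x‖ / (t₂ - t₁) := by
    rw [hv, norm_smul, norm_inv, Real.norm_of_nonneg hτ.le]
    ring
  have hcont : ContinuousOn (fun s => u s (γ s)) (Icc t₁ t₂) :=
    hs.u_C1.continuousOn.comp (f := fun s => (s, γ s)) (by fun_prop)
      (fun s hs => ⟨⟨h1.trans hs.1, hs.2.trans h2⟩, subset_closure (hγΩ s hs)⟩)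
  have hu1 := hs.u_C2.of_le (show (1 : WithTop ℕ∞) ≤ 2 by norm_num)
  have hder : ∀ s ∈ Ioo t₁ t₂, ∃ D, HasDerivAt (fun s => u s (γ s)) D s ∧
      -(K + A * (1 + ‖y - x‖ / (t₂ - t₁)) ^ r) ≤ D := by
    intro s hsI
    have hsT : s ∈ Ioo 0 T := ⟨h1.trans_lt hsI.1, hsI.2.trans_le h2⟩
    have hsΩ := hγΩ s (Ioo_subset_Icc_self hsI)
    obtain ⟨L, hL, -, hLt, hLx⟩ := hasFDerivAt_slices ho hu1 hsT hsΩ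
    have h3 : HasDerivAt (fun s => (s, γ s)) (1, v) s := (hasDerivAt_id s).prodMk (hγd s)
    refine ⟨L (1, v), HasFDerivAt.comp_hasDerivAt (l := fun z : ℝ × EuclideanSpace ℝ (Fin d) => u z.1 z.2)
      s hL h3, ?_⟩
    have h4 : L (1, v) = L (1, 0) + L (0, v) := by
      rw [← map_add]
      simp
    have h5 : L (0, v) = inner ℝ (gradient (u s) (γ s)) v := by
      rw [inner_gradient, hLx.fderiv]
      rfl
    have h6 := hs.hamiltonJacobi s hsT _ hsΩ
    rw [hLt.deriv] at h6
    have h7 := hK s hsT _ hsΩ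
    have h8 := hA (gradient (u s) (γ s)) v
    rw [hv'] at h8
    rw [h4, h5]
    linarith
  have := (convex_Icc t₁ t₂).mul_sub_le_image_sub_of_le_deriv hcont
    (fun s hs => by
      rw [interior_Icc] at hs
      obtain ⟨D, hD, -⟩ := hder s hs
      exact hD.differentiableAt.differentiableWithinAt)
    (fun s hs => by
      rw [interior_Icc] at hs
      obtain ⟨D, hD, hle⟩ := hder s hs
      rw [hD.deriv]
      exact hle) t₁ ⟨le_rfl, h12.le⟩ t₂ ⟨h12.le, le_rfl⟩ h12.le
  have e1 : γ t₁ = x := by simp [hγ]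
  have e2 : γ t₂ = y := by
    simp only [hγ, hv]
    rw [smul_inv_smul₀ hτ.ne', add_sub_cancel]
  simp only [e1, e2] at this
  linarith

lemma _root_.IsClassicalPair.le_along_segment_closure (hs : IsClassicalPair Ω T H f ε V u m)
    (hΩ : Convex ℝ Ω) (ho : IsOpen Ω) {A r K : ℝ} (hr : 0 ≤ r)
    (hA : ∀ p v : EuclideanSpace ℝ (Fin d), -(A * (1 + ‖v‖) ^ r) ≤ H p + inner ℝ p v)
    (hK : ∀ t ∈ Ioo 0 T, ∀ x ∈ Ω, fEps f ε (m t x) + V x ≤ K) {t₁ t₂ : ℝ} (h1 : 0 ≤ t₁)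
    (h12 : t₁ < t₂) (h2 : t₂ ≤ T) {x y : EuclideanSpace ℝ (Fin d)} (hx : x ∈ closure Ω)
    (hy : y ∈ closure Ω) :
    u t₁ x ≤ u t₂ y + (t₂ - t₁) * (K + A * (1 + ‖y - x‖ / (t₂ - t₁)) ^ r) := by
  have hc1 := hs.u_continuousOn (t := t₁) ⟨h1, h12.le.trans h2⟩
  have hc2 := hs.u_continuousOn (t := t₂) ⟨h1.trans h12.le, h2⟩
  have step : ∀ x' ∈ Ω, u t₁ x' ≤ u t₂ y + (t₂ - t₁) * (K + A * (1 + ‖y - x'‖ / (t₂ - t₁)) ^ r) := by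
    intro x' hx'
    have h3 : Continuous fun y' : EuclideanSpace ℝ (Fin d) => (1 + ‖y' - x'‖ / (t₂ - t₁)) ^ r :=
      Continuous.rpow_const (by fun_prop) fun _ => Or.inr hr
    have h4 : Continuous fun y' : EuclideanSpace ℝ (Fin d) =>
      (t₂ - t₁) * (K + A * (1 + ‖y' - x'‖ / (t₂ - t₁)) ^ r) := by fun_prop
    exact le_on_closure (fun y' hy' => hs.le_along_segment hΩ ho hA hK h1 h12 h2 hx' hy')
      continuousOn_const (hc2.add h4.continuousOn) hy
  have h3 : Continuous fun x' : EuclideanSpace ℝ (Fin d) => (1 + ‖y - x'‖ / (t₂ - t₁)) ^ r :=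
    Continuous.rpow_const (by fun_prop) fun _ => Or.inr hr
  have h4 : Continuous fun x' : EuclideanSpace ℝ (Fin d) =>
    u t₂ y + (t₂ - t₁) * (K + A * (1 + ‖y - x'‖ / (t₂ - t₁)) ^ r) := by fun_prop
  exact le_on_closure step hc1 h4.continuousOn hx

lemma exists_le_add_div_rpow (hq : 1 < q) (hH : IsPowerHamiltonian q H) (hΩ : Convex ℝ Ω)
    (ho : IsOpen Ω) (hb : Bornology.IsBounded Ω) (hT : 0 < T) (K : ℝ) :
    ∃ C : ℝ, 0 ≤ C ∧ ∀ (f : ℝ → ℝ) (ε : ℝ) (V : EuclideanSpace ℝ (Fin d) → ℝ)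
      (u m : ℝ → EuclideanSpace ℝ (Fin d) → ℝ), IsClassicalPair Ω T H f ε V u m →
      (∀ t ∈ Ioo 0 T, ∀ x ∈ Ω, fEps f ε (m t x) + V x ≤ K) →
      ∀ t₁ t₂, 0 ≤ t₁ → t₁ < t₂ → t₂ ≤ T → ∀ x ∈ closure Ω, ∀ y ∈ closure Ω,
        u t₁ x ≤ u t₂ y + C / (t₂ - t₁) ^ (1 / (q - 1)) := by
  obtain ⟨A, hA0, hA⟩ := exists_lagrangian_bound hq hH
  set D := Metric.diam (closure Ω) with hD
  have hD0 : 0 ≤ D := Metric.diam_nonneg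
  set r := q / (q - 1) with hr
  have hq1 : 0 < q - 1 := by linarith
  have hr0 : 0 ≤ r := by positivity
  have hr1 : r = 1 + 1 / (q - 1) := by
    rw [hr]
    field_simp
    ring
  refine ⟨|K| * T ^ r + A * (T + D) ^ r, by positivity, ?_⟩
  intro f ε V u m hs hK t₁ t₂ h1 h12 h2 x hx y hy
  have hτ : 0 < t₂ - t₁ := sub_pos.2 h12
  refine (hs.le_along_segment_closure hΩ ho hr0 hA hK h1 h12 h2 hx hy).trans ?_
  set τ := t₂ - t₁ with hτdef
  have hτT : τ ≤ T := by linarith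
  have hxy : ‖y - x‖ ≤ D := by
    rw [← dist_eq_norm]
    exact Metric.dist_le_diam_of_mem hb.closure hy hx
  gcongr
  rw [le_div_iff₀ (by positivity)]
  have e1 : τ * τ ^ (1 / (q - 1)) = τ ^ r := by
    rw [hr1, Real.rpow_add hτ, Real.rpow_one]
  have e2 : (1 + ‖y - x‖ / τ) = (τ + ‖y - x‖) / τ := by field_simp
  have e3 : τ ^ r ≠ 0 := (Real.rpow_pos_of_pos hτ r).ne'
  calc τ * (K + A * (1 + ‖y - x‖ / τ) ^ r) * τ ^ (1 / (q - 1))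
      = (τ * τ ^ (1 / (q - 1))) * (K + A * (1 + ‖y - x‖ / τ) ^ r) := by ring
    _ = K * τ ^ r + A * (τ + ‖y - x‖) ^ r := by
        rw [e1, e2, Real.div_rpow (by positivity) hτ.le]
        field_simp
    _ ≤ |K| * T ^ r + A * (T + D) ^ r := by
        gcongr
        exact le_abs_self K

end HamiltonJacobi

section Density

variable {d : ℕ} {Ω : Set (EuclideanSpace ℝ (Fin d))} {g m₁ : EuclideanSpace ℝ (Fin d) → ℝ}

lemma isFiniteMeasure_restrict (hb : Bornology.IsBounded Ω) :
    IsFiniteMeasure (volume.restrict Ω) := ⟨by simpa using hb.measure_lt_top⟩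

lemma integrable_density (hb : Bornology.IsBounded Ω) (hm : IsBoundedDensity Ω m₁) :
    Integrable m₁ (volume.restrict Ω) := by
  have := isFiniteMeasure_restrict hb
  exact hm.1.integrable le_top

lemma integrable_mul_of_continuousOn (ho : IsOpen Ω) (hb : Bornology.IsBounded Ω)
    (hg : ContinuousOn g (closure Ω)) {φ : EuclideanSpace ℝ (Fin d) → ℝ}
    (hφ : Integrable φ (volume.restrict Ω)) :
    Integrable (fun x => g x * φ x) (volume.restrict Ω) := by
  obtain ⟨B, hB⟩ := hb.isCompact_closure.exists_bound_of_continuousOn hg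
  refine hφ.bdd_mul (c := B) ((hg.mono subset_closure).aestronglyMeasurable ho.measurableSet) ?_
  filter_upwards [ae_restrict_mem ho.measurableSet] with x hx using hB x (subset_closure hx)

lemma integrable_of_continuousOn_closure (hb : Bornology.IsBounded Ω)
    (hg : ContinuousOn g (closure Ω)) : Integrable g (volume.restrict Ω) :=
  (hg.integrableOn_compact hb.isCompact_closure).mono_set subset_closure

lemma setIntegral_mul_density_le (ho : IsOpen Ω) (hb : Bornology.IsBounded Ω)
    (hm : IsBoundedDensity Ω m₁) (hg : ContinuousOn g (closure Ω)) {c : ℝ}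
    (hle : ∀ x ∈ Ω, g x ≤ c) : ∫ x in Ω, g x * m₁ x ≤ c := by
  calc ∫ x in Ω, g x * m₁ x ≤ ∫ x in Ω, c * m₁ x := by
        refine integral_mono_ae (integrable_mul_of_continuousOn ho hb hg (integrable_density hb hm))
          ((integrable_density hb hm).const_mul c) ?_
        filter_upwards [hm.2.1, ae_restrict_mem ho.measurableSet] with x hx hxΩ
        exact mul_le_mul_of_nonneg_right (hle x hxΩ) hx
    _ = c := by rw [integral_const_mul, hm.2.2, mul_one]

lemma le_setIntegral_mul_density (ho : IsOpen Ω) (hb : Bornology.IsBounded Ω)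
    (hm : IsBoundedDensity Ω m₁) (hg : ContinuousOn g (closure Ω)) {c : ℝ}
    (hle : ∀ x ∈ Ω, c ≤ g x) : c ≤ ∫ x in Ω, g x * m₁ x := by
  have := setIntegral_mul_density_le ho hb hm hg.neg (c := -c) fun x hx => neg_le_neg (hle x hx)
  simp only [Pi.neg_apply, neg_mul, integral_neg] at this
  linarith

lemma le_on_closure_of_ae_le (ho : IsOpen Ω) (hg : ContinuousOn g (closure Ω)) {c : ℝ}
    (hle : ∀ᵐ x ∂volume.restrict Ω, g x ≤ c) : ∀ x ∈ closure Ω, g x ≤ c := by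
  have h1 : EqOn (fun x => max (g x) c) (fun _ => c) Ω := by
    refine Measure.eqOn_open_of_ae_eq (μ := volume) ?_ ho
      (ContinuousOn.sup (hg.mono subset_closure) continuousOn_const) continuousOn_const
    filter_upwards [hle] with x hx using max_eq_right hx
  exact le_on_closure (fun x hx => max_eq_right_iff.1 (h1 hx)) hg continuousOn_const

end Density

section Coupling

variable {f : ℝ → ℝ} {ε : ℝ}

lemma strictMonoOn_fEps (hf : IsCoupling f) (hε : 0 < ε) :
    StrictMonoOn (fEps f ε) (Ioi 0) := by
  intro a ha b hb hab
  have h1 := hf.2 ha hb hab.le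
  have h2 := Real.log_lt_log ha hab
  unfold fEps
  nlinarith

lemma exists_continuous_fEps_inverse (hf : IsCoupling f) (hε : 0 < ε) :
    ∃ F : ℝ → ℝ, Continuous F ∧ ∀ y, 0 < F y ∧ fEps f ε (F y) = y := by
  set φ : ℝ → ℝ := fun y => fEps f ε (Real.exp y) with hφ
  have hφ' : ∀ y, φ y = f (Real.exp y) + ε * y := fun y => by
    simp only [hφ, fEps, Real.log_exp]
  have hmono : StrictMono φ := fun a b hab =>
    strictMonoOn_fEps hf hε (Real.exp_pos a) (Real.exp_pos b) (Real.exp_lt_exp.2 hab)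
  have hcont : Continuous φ := by
    have h1 : Continuous fun y => f (Real.exp y) :=
      hf.1.continuousOn.comp_continuous Real.continuous_exp fun y => Real.exp_pos y
    rw [funext hφ']
    exact h1.add (continuous_const.mul continuous_id)
  have htop : Tendsto φ atTop atTop := by
    refine tendsto_atTop_mono' atTop ?_
      (tendsto_atTop_add_const_left atTop (f 1) (tendsto_id.const_mul_atTop hε))
    filter_upwards [eventually_ge_atTop 0] with y hy
    have := hf.2 (mem_Ioi.2 one_pos) (mem_Ioi.2 (Real.exp_pos y)) (Real.one_le_exp hy)
    rw [hφ']
    simpa using this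
  have hbot : Tendsto φ atBot atBot := by
    refine tendsto_atBot_mono' atBot ?_
      (tendsto_atBot_add_const_left atBot (f 1) (tendsto_id.const_mul_atBot hε))
    filter_upwards [eventually_le_atBot 0] with y hy
    have := hf.2 (mem_Ioi.2 (Real.exp_pos y)) (mem_Ioi.2 one_pos) (Real.exp_le_one_iff.2 hy)
    rw [hφ']
    simpa using this
  set e := hmono.orderIsoOfSurjective φ (hcont.surjective htop hbot) with he
  refine ⟨fun y => Real.exp (e.symm y), Real.continuous_exp.comp e.symm.continuous,
    fun y => ⟨Real.exp_pos _, ?_⟩⟩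
  have h1 : e (e.symm y) = φ (e.symm y) := rfl
  rw [OrderIso.apply_symm_apply] at h1
  exact h1.symm

end Coupling

section Solutions

variable {d : ℕ} {Ω : Set (EuclideanSpace ℝ (Fin d))} {T q ε : ℝ}
  {H : EuclideanSpace ℝ (Fin d) → ℝ} {f : ℝ → ℝ} {V m₀ m₁ : EuclideanSpace ℝ (Fin d) → ℝ}
  {u m : ℝ → EuclideanSpace ℝ (Fin d) → ℝ}

/-- The planning conditions are the penalized conditions with `δ = 0`. -/
lemma exists_penalty (hΩo : IsOpen Ω) (hT : 0 < T)
    (h : IsPlanningOrPenalizedSolution Ω T H f ε V m₀ m₁ u m) :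
    IsClassicalPair Ω T H f ε V u m ∧ ∃ δ : ℝ, 0 ≤ δ ∧
      (∀ᵐ x ∂volume.restrict Ω, 0 < m₀ x ∧ δ * u 0 x = fEps f ε (m₀ x) - fEps f ε (m 0 x)) ∧
      (∀ᵐ x ∂volume.restrict Ω, 0 < m₁ x ∧ δ * u T x = fEps f ε (m T x) - fEps f ε (m₁ x)) := by
  obtain ⟨-, -, -, ⟨hs, h0, h1⟩ | ⟨δ, hδ, hs, hp0, hp1, h0, h1⟩⟩ := h
  · refine ⟨hs, 0, le_rfl, ?_, ?_⟩
    · filter_upwards [h0, ae_restrict_mem hΩo.measurableSet] with x hx hxΩ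
      rw [← hx]
      exact ⟨hs.m_pos 0 ⟨le_rfl, hT.le⟩ x (subset_closure hxΩ), by ring⟩
    · filter_upwards [h1, ae_restrict_mem hΩo.measurableSet] with x hx hxΩ
      rw [← hx]
      exact ⟨hs.m_pos T ⟨hT.le, le_rfl⟩ x (subset_closure hxΩ), by ring⟩
  · refine ⟨hs, δ, hδ.le, ?_, ?_⟩
    · filter_upwards [h0, hp0] with x hx hpx
      rw [hx]
      exact ⟨hpx, by field_simp⟩
    · filter_upwards [h1, hp1] with x hx hpx
      rw [hx]
      exact ⟨hpx, by field_simp⟩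

lemma _root_.IsClassicalPair.setIntegral_eq (hs : IsClassicalPair Ω T H f ε V u m)
    (hH : ContDiff ℝ 2 H) (hΩ : Convex ℝ Ω) (ho : IsOpen Ω)
    (hb : Bornology.IsBounded Ω) (hne : Ω.Nonempty) (hT : 0 < T) :
    ∫ x in Ω, m T x = ∫ x in Ω, m 0 x := by
  have h1 := hs.setIntegral_sub_le hH hΩ ho hb hne hT (k := fun _ => 1) (k' := fun _ => 0)
    (fun r => hasDerivAt_const r 1) continuous_const 0 0 (μ := fun _ => 0) continuousOn_const
    (c := 0) le_rfl (fun t _ x _ => by simp)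
  have h2 := hs.setIntegral_sub_le hH hΩ ho hb hne hT (k := fun _ => -1) (k' := fun _ => 0)
    (fun r => hasDerivAt_const r (-1)) continuous_const 0 0 (μ := fun _ => 0) continuousOn_const
    (c := 0) le_rfl (fun t _ x _ => by simp)
  simp only [sub_zero, one_mul, zero_mul, neg_mul, integral_neg] at h1 h2
  linarith

end Solutions

section LowerBound

/-- A `C¹` nondecreasing convex function which vanishes on the negative half line and grows
linearly. -/
noncomputable def softPos (r : ℝ) : ℝ := Real.sqrt (1 + (max r 0) ^ 2) - 1

lemma hasDerivAt_max_zero_sq (r : ℝ) :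
    HasDerivAt (fun r : ℝ => (max r 0) ^ 2) (2 * max r 0) r := by
  rcases lt_trichotomy r 0 with h | rfl | h
  · have h1 : (fun r : ℝ => (max r 0) ^ 2) =ᶠ[𝓝 r] fun _ => 0 := by
      filter_upwards [isOpen_Iio.mem_nhds h] with s hs
      rw [max_eq_right (le_of_lt hs)]
      simp
    rw [max_eq_right h.le, mul_zero]
    exact (hasDerivAt_const r (0 : ℝ)).congr_of_eventuallyEq h1
  · rw [hasDerivAt_iff_isLittleO_nhds_zero]
    simp only [max_self, zero_add, mul_zero, smul_eq_mul, sub_zero, ne_eq, OfNat.ofNat_ne_zero,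
      not_false_eq_true, zero_pow]
    refine Asymptotics.IsBigO.trans_isLittleO (g := fun h : ℝ => h ^ 2) ?_
      (by simpa using Asymptotics.isLittleO_pow_id one_lt_two)
    refine Asymptotics.IsBigO.of_bound 1 (Eventually.of_forall fun h => ?_)
    rw [one_mul, norm_pow, norm_pow]
    gcongr
    rw [Real.norm_eq_abs, Real.norm_eq_abs, abs_of_nonneg (le_max_right _ _)]
    exact max_le (le_abs_self h) (abs_nonneg h)
  · have h1 : (fun r : ℝ => (max r 0) ^ 2) =ᶠ[𝓝 r] fun r => r ^ 2 := by
      filter_upwards [isOpen_Ioi.mem_nhds h] with s hs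
      rw [max_eq_left (le_of_lt hs)]
    rw [max_eq_left h.le]
    simpa using (hasDerivAt_pow 2 r).congr_of_eventuallyEq h1

lemma hasDerivAt_softPos (r : ℝ) :
    HasDerivAt softPos (max r 0 / Real.sqrt (1 + (max r 0) ^ 2)) r := by
  have h1 := (((hasDerivAt_max_zero_sq r).const_add 1).sqrt (by positivity)).sub_const 1
  rw [mul_div_mul_left _ _ two_ne_zero] at h1
  exact h1

lemma softPos_of_nonpos {r : ℝ} (hr : r ≤ 0) : softPos r = 0 := by
  simp [softPos, max_eq_right hr]

lemma softPos_nonneg (r : ℝ) : 0 ≤ softPos r := by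
  rw [softPos, sub_nonneg, Real.one_le_sqrt]
  nlinarith [sq_nonneg (max r 0)]

lemma le_softPos_add_one (r : ℝ) : r ≤ softPos r + 1 := by
  rw [softPos, sub_add_cancel]
  refine (le_max_left r 0).trans (Real.le_sqrt_of_sq_le ?_)
  linarith

lemma monotone_softPos : Monotone softPos := by
  intro a b hab
  unfold softPos
  gcongr

variable {d : ℕ} {Ω : Set (EuclideanSpace ℝ (Fin d))} {T q ε : ℝ}
  {H : EuclideanSpace ℝ (Fin d) → ℝ} {f : ℝ → ℝ} {V m₀ m₁ : EuclideanSpace ℝ (Fin d) → ℝ}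
  {u m : ℝ → EuclideanSpace ℝ (Fin d) → ℝ}

lemma _root_.IsClassicalPair.setIntegral_softPos_le (hs : IsClassicalPair Ω T H f ε V u m)
    (hH : IsPowerHamiltonian q H) (hΩ : Convex ℝ Ω) (ho : IsOpen Ω)
    (hb : Bornology.IsBounded Ω) (hne : Ω.Nonempty) (hT : 0 < T) {R c₀ c₁ B₀ : ℝ}
    (hc₀ : 0 ≤ c₀) (hV : ∀ x ∈ Ω, |V x| ≤ R)
    (hF : ∀ s : ℝ, 0 < s → -(c₀ + c₁ * s) ≤ s * fEps f ε s)
    (hB₀ : ∀ x ∈ closure Ω, u 0 x ≤ B₀) :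
    ∫ x in Ω, softPos (u T x - ((|H 0| + R + c₁) * T + B₀)) * m T x ≤
      c₀ * T * volume.real Ω := by
  have h1 := hs.setIntegral_sub_le hH.1 hΩ ho hb hne hT hasDerivAt_softPos
    (by
      refine Continuous.div (by fun_prop) (by fun_prop) fun r => ?_
      positivity)
    (|H 0| + R + c₁) B₀ (μ := fun _ => 0) continuousOn_const hc₀ (fun t ht x hx => by
      set w := u t x - (|H 0| + R + c₁) * t - B₀
      set p := gradient (u t) x
      have hm : 0 < m t x := hs.m_pos t (Ioo_subset_Icc_self ht) x (subset_closure hx)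
      have e1 := hs.hamiltonJacobi t ht x hx
      have e2 := tangent_le hH p (-p)
      rw [add_neg_cancel, map_neg] at e2
      have e3 := hF _ hm
      have e4 := (abs_le.1 (hV x hx)).1
      have e5 := le_abs_self (H 0)
      have e6 : 0 ≤ max w 0 / Real.sqrt (1 + (max w 0) ^ 2) := by positivity
      have e7 : max w 0 / Real.sqrt (1 + (max w 0) ^ 2) ≤ 1 := by
        refine div_le_one_of_le₀ (Real.le_sqrt_of_sq_le (by linarith)) (by positivity)
      have e8 : (deriv (fun s => u s x) t - (|H 0| + R + c₁)) * (m t x - 0) -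
          m t x * fderiv ℝ H p p ≤ c₀ := by
        have : deriv (fun s => u s x) t = H p - fEps f ε (m t x) - V x := by linarith
        rw [this]
        have h9 : (H p - fderiv ℝ H p p - V x - (|H 0| + R)) * m t x ≤ 0 :=
          mul_nonpos_of_nonpos_of_nonneg (by linarith) hm.le
        nlinarith
      calc _ ≤ max w 0 / Real.sqrt (1 + (max w 0) ^ 2) * c₀ := mul_le_mul_of_nonneg_left e8 e6
        _ ≤ 1 * c₀ := mul_le_mul_of_nonneg_right e7 hc₀
        _ = c₀ := one_mul _)
  have h2 : ∫ x in Ω, softPos (u 0 x - (|H 0| + R + c₁) * 0 - B₀) * (m 0 x - 0) = 0 := by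
    rw [setIntegral_congr_fun (g := fun _ => (0 : ℝ)) ho.measurableSet, integral_zero]
    intro x hx
    simp only
    rw [softPos_of_nonpos, zero_mul]
    have := hB₀ x (subset_closure hx)
    linarith
  rw [h2, sub_zero] at h1
  simpa only [sub_zero, sub_sub] using h1

lemma setIntegral_terminal_le (h : IsPlanningOrPenalizedSolution Ω T H f ε V m₀ m₁ u m)
    (hf : IsCoupling f) (hε : 0 < ε)
    (hH : IsPowerHamiltonian q H) (hΩ : Convex ℝ Ω) (ho : IsOpen Ω)
    (hb : Bornology.IsBounded Ω) (hne : Ω.Nonempty) (hT : 0 < T) {R c₀ c₁ B₀ : ℝ}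
    (hR : 0 ≤ R) (hc₀ : 0 ≤ c₀) (hc₁ : 0 ≤ c₁) (hV : ∀ x ∈ Ω, |V x| ≤ R)
    (hF : ∀ s : ℝ, 0 < s → -(c₀ + c₁ * s) ≤ s * fEps f ε s)
    (hB₀ : ∀ x ∈ closure Ω, u 0 x ≤ B₀) :
    ∫ x in Ω, u T x * m₁ x ≤ B₀ + (|H 0| + R + c₁) * T + 1 + c₀ * T * volume.real Ω := by
  obtain ⟨hs, δ, hδ, h0, h1⟩ := exists_penalty ho hT h
  obtain ⟨hm₀, hm₁, -, -⟩ := h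
  have key := hs.setIntegral_softPos_le hH hΩ ho hb hne hT hc₀ hV hF hB₀
  set B := (|H 0| + R + c₁) * T + B₀ with hB
  have h0mem : (0 : ℝ) ∈ Icc 0 T := ⟨le_rfl, hT.le⟩
  have hTmem : T ∈ Icc 0 T := ⟨hT.le, le_rfl⟩
  have hmono := strictMonoOn_fEps hf hε
  have hcs : ContinuousOn (fun x => softPos (u T x - B)) (closure Ω) :=
    (continuous_iff_continuousAt.2 fun r => (hasDerivAt_softPos r).continuousAt).comp_continuousOn
      ((hs.u_continuousOn hTmem).sub continuousOn_const)
  have hi₁ := integrable_density hb hm₁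
  have hi₀ := integrable_density hb hm₀
  have hiT := integrable_of_continuousOn_closure hb (hs.m_continuousOn hTmem)
  have hi0 := integrable_of_continuousOn_closure hb (hs.m_continuousOn h0mem)
  have hmass : softPos (-B) * (1 - ∫ x in Ω, m T x) ≤ 0 := by
    rcases le_total 0 B with hB0 | hB0
    · rw [softPos_of_nonpos (by linarith), zero_mul]
    · refine mul_nonpos_of_nonneg_of_nonpos (softPos_nonneg _) ?_
      rw [hs.setIntegral_eq hH.1 hΩ ho hb hne hT, ← hm₀.2.2, sub_nonpos]
      refine integral_mono_ae hi₀ hi0 ?_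
      filter_upwards [h0, ae_restrict_mem ho.measurableSet] with x hx hxΩ
      have h2 : u 0 x ≤ 0 := by
        have h3 := hB₀ x (subset_closure hxΩ)
        have h4 : 0 ≤ (|H 0| + R + c₁) * T := by positivity
        linarith
      refine (hmono.le_iff_le hx.1 (hs.m_pos 0 h0mem x (subset_closure hxΩ))).1 ?_
      have := mul_nonpos_of_nonneg_of_nonpos hδ h2
      linarith [hx.2]
  have hle : ∀ᵐ x ∂volume.restrict Ω, u T x * m₁ x ≤ (B + 1) * m₁ x +
      (softPos (u T x - B) * m T x + (softPos (-B) * m₁ x - softPos (-B) * m T x)) := by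
    filter_upwards [h1, ae_restrict_mem ho.measurableSet] with x hx hxΩ
    have hmp := hs.m_pos T hTmem x (subset_closure hxΩ)
    have h2 : (softPos (u T x - B) - softPos (-B)) * (m₁ x - m T x) ≤ 0 := by
      rcases le_total 0 (u T x) with hu | hu
      · refine mul_nonpos_of_nonneg_of_nonpos (sub_nonneg.2 (monotone_softPos (by linarith)))
          (sub_nonpos.2 ((hmono.le_iff_le hx.1 hmp).1 ?_))
        have := mul_nonneg hδ hu
        linarith [hx.2]
      · refine mul_nonpos_of_nonpos_of_nonneg (sub_nonpos.2 (monotone_softPos (by linarith)))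
          (sub_nonneg.2 ((hmono.le_iff_le hmp hx.1).1 ?_))
        have := mul_nonpos_of_nonneg_of_nonpos hδ hu
        linarith [hx.2]
    have h3 := mul_le_mul_of_nonneg_right (le_softPos_add_one (u T x - B)) hx.1.le
    linarith
  have hsT := integrable_mul_of_continuousOn ho hb hcs hiT
  have hj₁ : Integrable (fun x => softPos (-B) * m₁ x - softPos (-B) * m T x)
      (volume.restrict Ω) := (hi₁.const_mul _).sub (hiT.const_mul _)
  have hj₂ : Integrable (fun x => softPos (u T x - B) * m T x +
      (softPos (-B) * m₁ x - softPos (-B) * m T x)) (volume.restrict Ω) := hsT.add hj₁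
  have hint := integral_mono_ae
    (integrable_mul_of_continuousOn ho hb (hs.u_continuousOn hTmem) hi₁)
    ((hi₁.const_mul (B + 1)).add hj₂) hle
  simp only [Pi.add_apply] at hint
  rw [integral_add (hi₁.const_mul (B + 1)) hj₂, integral_add hsT hj₁,
    integral_sub (hi₁.const_mul _) (hiT.const_mul _), integral_const_mul, integral_const_mul,
    integral_const_mul, hm₁.2.2] at hint
  linarith

lemma neg_le_mul_fEps (hf : IsCoupling f) {c ε₀ : ℝ} (hc : ∀ s ∈ Ioc (0 : ℝ) 1, c ≤ s * f s)
    (hε : 0 < ε) (hε₀ : ε ≤ ε₀) {s : ℝ} (hs : 0 < s) :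
    -(|c| + ε₀ + |f 1| * s) ≤ s * fEps f ε s := by
  have hfs : s * fEps f ε s = s * f s + ε * (s * Real.log s) := by
    unfold fEps
    ring
  rw [hfs]
  rcases le_or_gt s 1 with h1 | h1
  · have e1 := hc s ⟨hs, h1⟩
    have e2 := neg_abs_le c
    have e3 : -1 ≤ s * Real.log s := by
      have := mul_le_mul_of_nonneg_left (Real.one_sub_inv_le_log_of_pos hs) hs.le
      rw [mul_sub, mul_inv_cancel₀ hs.ne'] at this
      linarith
    have e4 := mul_nonneg (abs_nonneg (f 1)) hs.le
    nlinarith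
  · have e1 := hf.2 (mem_Ioi.2 one_pos) (mem_Ioi.2 hs) h1.le
    have e2 := neg_abs_le (f 1)
    have e3 := Real.log_pos h1
    have e4 : 0 ≤ ε * (s * Real.log s) := by positivity
    have e5 : s * (-|f 1|) ≤ s * f s := mul_le_mul_of_nonneg_left (by linarith) hs.le
    have e6 := abs_nonneg c
    linarith

end LowerBound

section Comparison

variable {d : ℕ} {Ω : Set (EuclideanSpace ℝ (Fin d))} {T q ε : ℝ}
  {H : EuclideanSpace ℝ (Fin d) → ℝ} {f : ℝ → ℝ} {V m₀ m₁ : EuclideanSpace ℝ (Fin d) → ℝ}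
  {u m : ℝ → EuclideanSpace ℝ (Fin d) → ℝ}

/-- Comparison of `(u, m)` with the solution `(lam t + b, μ)`, where `f^ε(μ) = H(0) - lam - V`. -/
lemma _root_.IsClassicalPair.setIntegral_comparison (hs : IsClassicalPair Ω T H f ε V u m)
    (hf : IsCoupling f) (hε : 0 < ε) (hH : IsPowerHamiltonian q H) (hH0 : gradient H 0 = 0)
    (hΩ : Convex ℝ Ω) (ho : IsOpen Ω) (hb : Bornology.IsBounded Ω) (hne : Ω.Nonempty)
    (hT : 0 < T) {k k' : ℝ → ℝ} (hk : ∀ r, HasDerivAt k (k' r) r) (hk' : Continuous k')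
    (hk0 : ∀ r, 0 ≤ k' r) (lam b : ℝ) {μ : EuclideanSpace ℝ (Fin d) → ℝ}
    (hμ : ContinuousOn μ (closure Ω)) (hμ0 : ∀ x ∈ Ω, 0 < μ x)
    (hμV : ∀ x ∈ Ω, fEps f ε (μ x) = H 0 - lam - V x) :
    ∫ x in Ω, k (u T x - (lam * T + b)) * (m T x - μ x) ≤
      ∫ x in Ω, k (u 0 x - b) * (m 0 x - μ x) := by
  have h1 := hs.setIntegral_sub_le hH.1 hΩ ho hb hne hT hk hk' lam b hμ (c := 0) le_rfl
    (fun t ht x hx => by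
      refine mul_nonpos_of_nonneg_of_nonpos (hk0 _) ?_
      set p := gradient (u t) x
      have hm : 0 < m t x := hs.m_pos t (Ioo_subset_Icc_self ht) x (subset_closure hx)
      have e1 := hs.hamiltonJacobi t ht x hx
      have e2 := tangent_le hH p (-p)
      rw [add_neg_cancel, map_neg] at e2
      have e3 := tangent_le hH 0 p
      rw [← inner_gradient, hH0, inner_zero_left, zero_add, add_zero] at e3
      have e4 : 0 ≤ (fEps f ε (m t x) - fEps f ε (μ x)) * (m t x - μ x) := by
        have hmono := strictMonoOn_fEps hf hε
        rcases le_total (m t x) (μ x) with h | h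
        · exact mul_nonneg_of_nonpos_of_nonpos
            (sub_nonpos.2 ((hmono.le_iff_le hm (hμ0 x hx)).2 h)) (sub_nonpos.2 h)
        · exact mul_nonneg (sub_nonneg.2 ((hmono.le_iff_le (hμ0 x hx) hm).2 h)) (sub_nonneg.2 h)
      have e5 : deriv (fun s => u s x) t - lam =
          H p - H 0 - (fEps f ε (m t x) - fEps f ε (μ x)) := by
        rw [hμV x hx]
        linarith
      have e6 : 0 ≤ m t x * (H 0 - H p + fderiv ℝ H p p) := mul_nonneg hm.le (by linarith)
      have e7 : 0 ≤ μ x * (H p - H 0) := mul_nonneg (hμ0 x hx).le (by linarith)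
      rw [e5]
      linarith)
  simp only [mul_zero, sub_zero, zero_mul, sub_sub, sub_nonpos] at h1
  exact h1

lemma exists_stationary_density (hf : IsCoupling f) (hε : 0 < ε) (hV : ∃ L, LipschitzOnWith L V Ω)
    (a : ℝ) : ∃ μ : EuclideanSpace ℝ (Fin d) → ℝ, Continuous μ ∧
      ∀ x ∈ Ω, 0 < μ x ∧ fEps f ε (μ x) = a - V x := by
  obtain ⟨L, hL⟩ := hV
  obtain ⟨W, hW, hVW⟩ := hL.extend_real
  obtain ⟨F, hF, hFe⟩ := exists_continuous_fEps_inverse hf hε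
  refine ⟨fun x => F (a - W x), hF.comp (continuous_const.sub hW.continuous), fun x hx => ?_⟩
  rw [hVW hx]
  exact hFe _

/-- An integral inequality forces a sign: if `k ∘ w` has the sign of `φ` and `∫ k(w) φ ≤ 0`, then
`w ≤ 0`. -/
lemma nonpos_of_setIntegral_mul_nonpos (ho : IsOpen Ω) {w φ : EuclideanSpace ℝ (Fin d) → ℝ}
    (hw : ContinuousOn w (closure Ω))
    (hi : Integrable (fun x => (max (w x) 0) ^ 2 * φ x) (volume.restrict Ω))
    (hφ : ∀ᵐ x ∂volume.restrict Ω, 0 < w x → 0 < φ x)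
    (h : ∫ x in Ω, (max (w x) 0) ^ 2 * φ x ≤ 0) : ∀ x ∈ closure Ω, w x ≤ 0 := by
  have h0 : 0 ≤ᵐ[volume.restrict Ω] fun x => (max (w x) 0) ^ 2 * φ x := by
    filter_upwards [hφ] with x hx
    rcases le_or_gt (w x) 0 with hwx | hwx
    · simp [max_eq_right hwx]
    · exact mul_nonneg (sq_nonneg _) (hx hwx).le
  have h1 := (integral_eq_zero_iff_of_nonneg_ae h0 hi).1 (le_antisymm h (integral_nonneg_of_ae h0))
  refine le_on_closure_of_ae_le ho hw ?_
  filter_upwards [h1, hφ] with x hx hx'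
  by_contra hcon
  rw [not_le] at hcon
  have h2 : 0 < (max (w x) 0) ^ 2 * φ x := by
    rw [max_eq_left hcon.le]
    exact mul_pos (by positivity) (hx' hcon)
  exact h2.ne' hx

lemma not_ae_lt_of_setIntegral_le (ho : IsOpen Ω) (hne : Ω.Nonempty)
    {φ ψ : EuclideanSpace ℝ (Fin d) → ℝ} (hφ : Integrable φ (volume.restrict Ω))
    (hψ : Integrable ψ (volume.restrict Ω)) (h : ∫ x in Ω, ψ x ≤ ∫ x in Ω, φ x) :
    ¬ ∀ᵐ x ∂volume.restrict Ω, φ x < ψ x := by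
  intro hlt
  have h0 : 0 ≤ᵐ[volume.restrict Ω] fun x => ψ x - φ x := by
    filter_upwards [hlt] with x hx using sub_nonneg.2 hx.le
  have h1 := (integral_eq_zero_iff_of_nonneg_ae h0 (hψ.sub hφ)).1
    (le_antisymm (by rw [integral_sub hψ hφ]; linarith) (integral_nonneg_of_ae h0))
  have h2 : volume.restrict Ω ≠ 0 := by
    rw [Ne, Measure.restrict_eq_zero]
    exact (ho.measure_pos volume hne).ne'
  have : (ae (volume.restrict Ω)).NeBot := ae_neBot.2 h2
  obtain ⟨x, hx, hx'⟩ := (hlt.and h1).exists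
  simp only [Pi.zero_apply] at hx'
  linarith

/-- `u(T)` is bounded by `max u(0) + lam T`, and `u(0)` is bounded below by `min u(T) - lam T`. -/
lemma initial_terminal_bounds (h : IsPlanningOrPenalizedSolution Ω T H f ε V m₀ m₁ u m)
    (hf : IsCoupling f) (hε : 0 < ε) (hH : IsPowerHamiltonian q H) (hH0 : gradient H 0 = 0)
    (hΩ : Convex ℝ Ω) (ho : IsOpen Ω) (hb : Bornology.IsBounded Ω) (hne : Ω.Nonempty)
    (hT : 0 < T) {lam : ℝ} (hlam : 0 ≤ lam)
    (hlow₀ : ∀ᵐ x ∂volume.restrict Ω, H 0 - lam - V x < fEps f ε (m₀ x))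
    (hlow₁ : ∀ᵐ x ∂volume.restrict Ω, H 0 - lam - V x < fEps f ε (m₁ x)) :
    (∀ a, (∀ x ∈ closure Ω, u 0 x ≤ a) → ∀ x ∈ closure Ω, u T x ≤ lam * T + a) ∧
    (∀ a, (∀ x ∈ closure Ω, lam * T + a ≤ u T x) → ∀ x ∈ closure Ω, a ≤ u 0 x) := by
  obtain ⟨hs, δ, hδ, h0, h1⟩ := exists_penalty ho hT h
  obtain ⟨hm₀, hm₁, hV, -⟩ := h
  obtain ⟨μ, hμc, hμ⟩ := exists_stationary_density hf hε hV (H 0 - lam)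
  have h0mem : (0 : ℝ) ∈ Icc 0 T := ⟨le_rfl, hT.le⟩
  have hTmem : T ∈ Icc 0 T := ⟨hT.le, le_rfl⟩
  have hmono := strictMonoOn_fEps hf hε
  have hlamT : 0 ≤ lam * T := mul_nonneg hlam hT.le
  have hi₁ := integrable_density hb hm₁
  have hi₀ := integrable_density hb hm₀
  have hiT := integrable_of_continuousOn_closure hb (hs.m_continuousOn hTmem)
  have hi0 := integrable_of_continuousOn_closure hb (hs.m_continuousOn h0mem)
  have hmass := hs.setIntegral_eq hH.1 hΩ ho hb hne hT
  have hμint : ∀ {w : EuclideanSpace ℝ (Fin d) → ℝ} {s : ℝ}, s ∈ Icc 0 T →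
      ContinuousOn w (closure Ω) →
      Integrable (fun x => (max (w x) 0) ^ 2 * (m s x - μ x)) (volume.restrict Ω) :=
    fun hs' hw => integrable_of_continuousOn_closure hb
      (((hw.sup continuousOn_const).pow 2).mul ((hs.m_continuousOn hs').sub hμc.continuousOn))
  have upper : ∀ b, (∀ x ∈ closure Ω, u 0 x ≤ b) → (δ = 0 ∨ 0 ≤ lam * T + b) →
      ∀ x ∈ closure Ω, u T x ≤ lam * T + b := by
    intro b hb0 hδb
    have hcmp := hs.setIntegral_comparison hf hε hH hH0 hΩ ho hb hne hT hasDerivAt_max_zero_sq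
      (by fun_prop) (fun r => by positivity) lam b hμc.continuousOn (fun x hx => (hμ x hx).1)
      (fun x hx => (hμ x hx).2)
    have hz : ∫ x in Ω, (max (u 0 x - b) 0) ^ 2 * (m 0 x - μ x) = 0 := by
      rw [setIntegral_congr_fun (g := fun _ => (0 : ℝ)) ho.measurableSet, integral_zero]
      intro x hx
      simp only
      rw [max_eq_right (sub_nonpos.2 (hb0 x (subset_closure hx)))]
      ring
    rw [hz] at hcmp
    have hw : ContinuousOn (fun x => u T x - (lam * T + b)) (closure Ω) :=
      (hs.u_continuousOn hTmem).sub continuousOn_const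
    have := nonpos_of_setIntegral_mul_nonpos ho hw (hμint hTmem hw) ?_ hcmp
    · exact fun x hx => sub_nonpos.1 (this x hx)
    · filter_upwards [h1, hlow₁, ae_restrict_mem ho.measurableSet] with x hx hlx hxΩ hpos
      rw [sub_pos]
      refine (hmono.lt_iff_lt (hμ x hxΩ).1 (hs.m_pos T hTmem x (subset_closure hxΩ))).1 ?_
      have h3 : 0 ≤ δ * u T x := by
        rcases hδb with hδ0 | hδb
        · rw [hδ0, zero_mul]
        · exact mul_nonneg hδ (by linarith)
      rw [(hμ x hxΩ).2]
      linarith [hx.2]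
  have lower : ∀ b, (∀ x ∈ closure Ω, lam * T + b ≤ u T x) → (δ = 0 ∨ b ≤ 0) →
      ∀ x ∈ closure Ω, b ≤ u 0 x := by
    intro b hb0 hδb
    have hcmp := hs.setIntegral_comparison hf hε hH hH0 hΩ ho hb hne hT
      (k := fun r => -(max (-r) 0) ^ 2) (k' := fun r => 2 * max (-r) 0)
      (fun r => by
        have := ((hasDerivAt_max_zero_sq (-r)).comp r (hasDerivAt_neg r)).neg
        rw [mul_neg_one, neg_neg] at this
        exact this)
      (by fun_prop) (fun r => by positivity) lam b hμc.continuousOn (fun x hx => (hμ x hx).1)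
      (fun x hx => (hμ x hx).2)
    have hz : ∫ x in Ω, -(max (-(u T x - (lam * T + b))) 0) ^ 2 * (m T x - μ x) = 0 := by
      rw [setIntegral_congr_fun (g := fun _ => (0 : ℝ)) ho.measurableSet, integral_zero]
      intro x hx
      have := hb0 x (subset_closure hx)
      simp only
      rw [max_eq_right (by linarith)]
      ring
    rw [hz] at hcmp
    simp only [neg_sub, neg_mul, integral_neg, Left.nonneg_neg_iff] at hcmp
    have hw : ContinuousOn (fun x => b - u 0 x) (closure Ω) :=
      continuousOn_const.sub (hs.u_continuousOn h0mem)
    have := nonpos_of_setIntegral_mul_nonpos ho hw (hμint h0mem hw) ?_ hcmp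
    · exact fun x hx => sub_nonpos.1 (this x hx)
    · filter_upwards [h0, hlow₀, ae_restrict_mem ho.measurableSet] with x hx hlx hxΩ hpos
      rw [sub_pos]
      refine (hmono.lt_iff_lt (hμ x hxΩ).1 (hs.m_pos 0 h0mem x (subset_closure hxΩ))).1 ?_
      have h3 : δ * u 0 x ≤ 0 := by
        rcases hδb with hδ0 | hδb
        · rw [hδ0, zero_mul]
        · exact mul_nonpos_of_nonneg_of_nonpos hδ (by linarith)
      rw [(hμ x hxΩ).2]
      linarith [hx.2]
  refine ⟨fun a ha => ?_, fun a ha => ?_⟩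
  · rcases hδ.eq_or_lt with hδ0 | hδ0
    · exact upper a ha (Or.inl hδ0.symm)
    · refine upper a ha (Or.inr ?_)
      by_contra hneg
      rw [not_le] at hneg
      have hT0 := upper (-(lam * T)) (fun x hx => (ha x hx).trans (by linarith))
        (Or.inr (by linarith))
      refine not_ae_lt_of_setIntegral_le ho hne hi₀ hi0 ?_ ?_
      · rw [← hmass, hm₀.2.2, ← hm₁.2.2]
        refine integral_mono_ae hiT hi₁ ?_
        filter_upwards [h1, ae_restrict_mem ho.measurableSet] with x hx hxΩ
        refine (hmono.le_iff_le (hs.m_pos T hTmem x (subset_closure hxΩ)) hx.1).1 ?_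
        have h2 := hT0 x (subset_closure hxΩ)
        have := mul_nonpos_of_nonneg_of_nonpos hδ (show u T x ≤ 0 by linarith)
        linarith [hx.2]
      · filter_upwards [h0, ae_restrict_mem ho.measurableSet] with x hx hxΩ
        refine (hmono.lt_iff_lt hx.1 (hs.m_pos 0 h0mem x (subset_closure hxΩ))).1 ?_
        have h2 := ha x (subset_closure hxΩ)
        have := mul_neg_of_pos_of_neg hδ0 (show u 0 x < 0 by linarith)
        linarith [hx.2]
  · rcases hδ.eq_or_lt with hδ0 | hδ0
    · exact lower a ha (Or.inl hδ0.symm)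
    · refine lower a ha (Or.inr ?_)
      by_contra hpos
      rw [not_le] at hpos
      have hT0 := lower 0 (fun x hx => le_trans (by linarith) (ha x hx)) (Or.inr le_rfl)
      refine not_ae_lt_of_setIntegral_le ho hne hi₁ hiT ?_ ?_
      · rw [hmass, hm₁.2.2, ← hm₀.2.2]
        refine integral_mono_ae hi0 hi₀ ?_
        filter_upwards [h0, ae_restrict_mem ho.measurableSet] with x hx hxΩ
        refine (hmono.le_iff_le (hs.m_pos 0 h0mem x (subset_closure hxΩ)) hx.1).1 ?_
        have := mul_nonneg hδ (hT0 x (subset_closure hxΩ))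
        linarith [hx.2]
      · filter_upwards [h1, ae_restrict_mem ho.measurableSet] with x hx hxΩ
        refine (hmono.lt_iff_lt hx.1 (hs.m_pos T hTmem x (subset_closure hxΩ))).1 ?_
        have h2 := ha x (subset_closure hxΩ)
        have := mul_pos hδ0 (show 0 < u T x by linarith)
        linarith [hx.2]

end Comparison

section Estimates

variable {d : ℕ} {Ω : Set (EuclideanSpace ℝ (Fin d))} {T q : ℝ}
  {H : EuclideanSpace ℝ (Fin d) → ℝ}

theorem local_upper_estimate (hq : 1 < q) (hH : IsPowerHamiltonian q H) (hΩ : Convex ℝ Ω)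
    (ho : IsOpen Ω) (hb : Bornology.IsBounded Ω) (hT : 0 < T) (K : ℝ) :
    ∃ C₁ : ℝ, ∀ (f : ℝ → ℝ) (ε : ℝ) (V m₀ m₁ : EuclideanSpace ℝ (Fin d) → ℝ)
        (u m : ℝ → EuclideanSpace ℝ (Fin d) → ℝ),
        IsPlanningOrPenalizedSolution Ω T H f ε V m₀ m₁ u m →
        (∀ t ∈ Ioo 0 T, ∀ x ∈ Ω, fEps f ε (m t x) + V x ≤ K) →
        ∀ t ∈ Ioo 0 T, ∀ x ∈ Ω,
          normalized Ω T m₁ u t x ≤ C₁ / (T - t) ^ (1 / (q - 1)) := by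
  obtain ⟨C, -, hC⟩ := exists_le_add_div_rpow hq hH hΩ ho hb hT K
  refine ⟨C, fun f ε V m₀ m₁ u m h hK t ht x hx => ?_⟩
  have hs := (exists_penalty ho hT h).1
  have h1 : u t x - C / (T - t) ^ (1 / (q - 1)) ≤ ∫ y in Ω, u T y * m₁ y := by
    refine le_setIntegral_mul_density ho hb h.2.1 (hs.u_continuousOn ⟨hT.le, le_rfl⟩) fun y hy => ?_
    have := hC f ε V u m hs hK t T ht.1.le ht.2 le_rfl x (subset_closure hx) y (subset_closure hy)
    linarith
  unfold normalized
  linarith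

theorem local_lower_estimate (hq : 1 < q) (hH : IsPowerHamiltonian q H) (hΩ : Convex ℝ Ω)
    (ho : IsOpen Ω) (hb : Bornology.IsBounded Ω) (hne : Ω.Nonempty) (hT : 0 < T) {f : ℝ → ℝ}
    (hf : IsCoupling f) {c : ℝ} (hc : ∀ s ∈ Ioc (0 : ℝ) 1, c ≤ s * f s) (ε₀ R K : ℝ) :
    ∃ C₀ : ℝ, ∀ (ε : ℝ) (V m₀ m₁ : EuclideanSpace ℝ (Fin d) → ℝ)
        (u m : ℝ → EuclideanSpace ℝ (Fin d) → ℝ), 0 < ε → ε ≤ ε₀ →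
        IsPlanningOrPenalizedSolution Ω T H f ε V m₀ m₁ u m →
        (∀ x ∈ Ω, |V x| ≤ R) →
        (∀ t ∈ Ioo 0 T, ∀ x ∈ Ω, fEps f ε (m t x) + V x ≤ K) →
        ∀ t ∈ Ioo 0 T, ∀ x ∈ Ω,
          -(C₀ / t ^ (1 / (q - 1))) ≤ normalized Ω T m₁ u t x := by
  obtain ⟨C, -, hC⟩ := exists_le_add_div_rpow hq hH hΩ ho hb hT K
  set E := (|H 0| + R + |f 1|) * T + 1 + (|c| + ε₀) * T * volume.real Ω with hE
  refine ⟨C + E * T ^ (1 / (q - 1)), fun ε V m₀ m₁ u m hε hε₀ h hV hK t ht x hx => ?_⟩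
  have hs := (exists_penalty ho hT h).1
  have hR : 0 ≤ R := (abs_nonneg _).trans (hV x hx)
  have hε₀' : 0 ≤ ε₀ := hε.le.trans hε₀
  have hE0 : 0 ≤ E := by positivity
  have hq1 : 0 < q - 1 := by linarith
  have h0mem : (0 : ℝ) ∈ Icc 0 T := ⟨le_rfl, hT.le⟩
  obtain ⟨y, hy, hymax⟩ := hb.isCompact_closure.exists_isMaxOn hne.closure
    (hs.u_continuousOn h0mem)
  have h1 := setIntegral_terminal_le h hf hε hH hΩ ho hb hne hT hR
    (add_nonneg (abs_nonneg c) hε₀') (abs_nonneg (f 1)) hV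
    (fun s hs => neg_le_mul_fEps hf hc hε hε₀ hs) (fun z hz => hymax hz)
  have h2 := hC f ε V u m hs hK 0 t le_rfl ht.1 ht.2.le y hy x (subset_closure hx)
  rw [sub_zero] at h2
  have h3 : E ≤ E * T ^ (1 / (q - 1)) / t ^ (1 / (q - 1)) := by
    rw [le_div_iff₀ (Real.rpow_pos_of_pos ht.1 _)]
    exact mul_le_mul_of_nonneg_left
      (Real.rpow_le_rpow ht.1.le ht.2.le (by positivity)) hE0
  rw [add_div]
  unfold normalized
  linarith

theorem global_estimate (hq : 1 < q) (hH : IsPowerHamiltonian q H) (hH0 : gradient H 0 = 0)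
    (hΩ : Convex ℝ Ω) (ho : IsOpen Ω) (hb : Bornology.IsBounded Ω) (hne : Ω.Nonempty)
    (hT : 0 < T) {f : ℝ → ℝ} (hf : IsCoupling f) (ε₀ R : ℝ) :
    ∃ C : ℝ, ∀ (ε : ℝ) (V m₀ m₁ : EuclideanSpace ℝ (Fin d) → ℝ)
        (u m : ℝ → EuclideanSpace ℝ (Fin d) → ℝ), 0 < ε → ε ≤ ε₀ →
        IsPlanningOrPenalizedSolution Ω T H f ε V m₀ m₁ u m →
        (∀ t ∈ Ioo 0 T, ∀ x ∈ Ω, |m t x| ≤ R) →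
        (∀ᵐ x ∂volume.restrict Ω, |ε * Real.log (m₀ x)| ≤ R) →
        (∀ᵐ x ∂volume.restrict Ω, |ε * Real.log (m₁ x)| ≤ R) →
        (∀ᵐ x ∂volume.restrict Ω, -R ≤ f (m₀ x)) →
        (∀ᵐ x ∂volume.restrict Ω, -R ≤ f (m₁ x)) →
        (∀ x ∈ Ω, |V x| ≤ R) →
        ∀ t ∈ Icc 0 T, ∀ x ∈ closure Ω, |normalized Ω T m₁ u t x| ≤ C := by
  set K := f R + ε₀ * |Real.log R| + R with hKdef
  obtain ⟨P, hP0, hP⟩ := exists_le_add_div_rpow hq hH hΩ ho hb hT K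
  obtain ⟨A, hA0, hA⟩ := exists_lagrangian_bound hq hH
  set lam := |H 0| + 3 * R + 1 with hlam
  refine ⟨P / T ^ (1 / (q - 1)) + 2 * (lam * T) + T * (|K| + A), ?_⟩
  intro ε V m₀ m₁ u m hε hε₀ h hm hl₀ hl₁ hf₀ hf₁ hV t ht x hx
  have hs := (exists_penalty ho hT h).1
  obtain ⟨x₀, hx₀⟩ := hne
  have hne : Ω.Nonempty := ⟨x₀, hx₀⟩
  have hmpos : ∀ s ∈ Ioo 0 T, ∀ y ∈ Ω, 0 < m s y := fun s hs' y hy =>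
    hs.m_pos s (Ioo_subset_Icc_self hs') y (subset_closure hy)
  have hR : 0 < R := by
    have h2 : T / 2 ∈ Ioo 0 T := ⟨by linarith, by linarith⟩
    exact (hmpos _ h2 _ hx₀).trans_le ((le_abs_self _).trans (hm _ h2 _ hx₀))
  have hlam0 : 0 ≤ lam := by positivity
  have hK : ∀ s ∈ Ioo 0 T, ∀ y ∈ Ω, fEps f ε (m s y) + V y ≤ K := by
    intro s hs' y hy
    have e1 := hmpos s hs' y hy
    have e2 : m s y ≤ R := (le_abs_self _).trans (hm s hs' y hy)
    have e3 := hf.2 (mem_Ioi.2 e1) (mem_Ioi.2 hR) e2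
    have e4 : ε * Real.log (m s y) ≤ ε₀ * |Real.log R| := by
      calc ε * Real.log (m s y) ≤ ε * |Real.log R| :=
            mul_le_mul_of_nonneg_left ((Real.log_le_log e1 e2).trans (le_abs_self _)) hε.le
        _ ≤ ε₀ * |Real.log R| := mul_le_mul_of_nonneg_right hε₀ (abs_nonneg _)
    have e5 := (le_abs_self _).trans (hV y hy)
    unfold fEps
    linarith
  have hlow : ∀ {m' : EuclideanSpace ℝ (Fin d) → ℝ},
      (∀ᵐ y ∂volume.restrict Ω, |ε * Real.log (m' y)| ≤ R) →
      (∀ᵐ y ∂volume.restrict Ω, -R ≤ f (m' y)) →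
      ∀ᵐ y ∂volume.restrict Ω, H 0 - lam - V y < fEps f ε (m' y) := by
    intro m' e1 e2
    filter_upwards [e1, e2, ae_restrict_mem ho.measurableSet] with y h1 h2 hy
    have e3 := (abs_le.1 h1).1
    have e4 := (abs_le.1 (hV y hy)).1
    have e5 := le_abs_self (H 0)
    unfold fEps
    linarith
  obtain ⟨hup, hlo⟩ := initial_terminal_bounds h hf hε hH hH0 hΩ ho hb hne hT hlam0
    (hlow hl₀ hf₀) (hlow hl₁ hf₁)
  have h0mem : (0 : ℝ) ∈ Icc 0 T := ⟨le_rfl, hT.le⟩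
  have hTmem : T ∈ Icc 0 T := ⟨hT.le, le_rfl⟩
  have hvert : ∀ s₁ s₂, 0 ≤ s₁ → s₁ ≤ s₂ → s₂ ≤ T → u s₁ x ≤ u s₂ x + T * (|K| + A) := by
    intro s₁ s₂ h1 h12 h2
    rcases h12.eq_or_lt with rfl | h12
    · have : 0 ≤ T * (|K| + A) := by positivity
      linarith
    · have hr : 0 ≤ q / (q - 1) := div_nonneg (by linarith) (by linarith)
      have h3 := hs.le_along_segment_closure hΩ ho hr hA hK h1 h12 h2 hx hx
      rw [sub_self, norm_zero, zero_div, add_zero, Real.one_rpow, mul_one] at h3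
      have h4 : (s₂ - s₁) * (K + A) ≤ T * (|K| + A) := by
        calc (s₂ - s₁) * (K + A) ≤ (s₂ - s₁) * (|K| + A) :=
              mul_le_mul_of_nonneg_left (by linarith [le_abs_self K]) (by linarith)
          _ ≤ T * (|K| + A) := mul_le_mul_of_nonneg_right (by linarith) (by positivity)
      linarith
  obtain ⟨y, hy, hymax⟩ := hb.isCompact_closure.exists_isMaxOn hne.closure
    (hs.u_continuousOn h0mem)
  obtain ⟨z, hz, hzmin⟩ := hb.isCompact_closure.exists_isMinOn hne.closure
    (hs.u_continuousOn hTmem)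
  have hTle := hup (u 0 y) (fun w hw => hymax hw)
  have h0ge := hlo (u T z - lam * T) (fun w hw => by
    have : u T z ≤ u T w := hzmin hw
    linarith)
  have hyz := hP f ε V u m hs hK 0 T le_rfl hT le_rfl y hy z hz
  rw [sub_zero] at hyz
  have i1 := setIntegral_mul_density_le ho hb h.2.1 (hs.u_continuousOn hTmem)
    (fun w hw => hTle w (subset_closure hw))
  have i2 : u T z ≤ ∫ w in Ω, u T w * m₁ w :=
    le_setIntegral_mul_density ho hb h.2.1 (hs.u_continuousOn hTmem)
      (fun w hw => hzmin (subset_closure hw))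
  have v1 := hvert t T ht.1 ht.2 le_rfl
  have v0 := hvert 0 t le_rfl ht.1 ht.2
  have j1 := hTle x hx
  have j2 := h0ge x hx
  have hlamT : 0 ≤ lam * T := mul_nonneg hlam0 hT.le
  unfold normalized
  rw [abs_le]
  constructor <;> linarith

end Estimates

end PlanningProblem

theorem mainTheorem12 (d : ℕ) (hd : 1 ≤ d) (Ω : Set (EuclideanSpace ℝ (Fin d)))
    (hΩ : IsC3ConvexDomain Ω) (T : ℝ) (hT : 0 < T) (q : ℝ) (hq : 1 < q)
    (H : EuclideanSpace ℝ (Fin d) → ℝ) (hH : IsPowerHamiltonian q H) :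
    -- global estimate
    (gradient H 0 = 0 → ∀ f : ℝ → ℝ, IsCoupling f → ∀ ε₀ R : ℝ, ∃ C : ℝ,
      ∀ (ε : ℝ) (V m₀ m₁ : EuclideanSpace ℝ (Fin d) → ℝ)
        (u m : ℝ → EuclideanSpace ℝ (Fin d) → ℝ), 0 < ε → ε ≤ ε₀ →
        IsPlanningOrPenalizedSolution Ω T H f ε V m₀ m₁ u m →
        (∀ t ∈ Ioo 0 T, ∀ x ∈ Ω, |m t x| ≤ R) →
        (∀ᵐ x ∂volume.restrict Ω, |ε * Real.log (m₀ x)| ≤ R) →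
        (∀ᵐ x ∂volume.restrict Ω, |ε * Real.log (m₁ x)| ≤ R) →
        (∀ᵐ x ∂volume.restrict Ω, -R ≤ f (m₀ x)) →
        (∀ᵐ x ∂volume.restrict Ω, -R ≤ f (m₁ x)) →
        W1InftyBound Ω V R →
        ∀ t ∈ Icc 0 T, ∀ x ∈ closure Ω, |normalized Ω T m₁ u t x| ≤ C) ∧
    -- local estimate from above
    (∀ K : ℝ, ∃ C₁ : ℝ, ∀ (f : ℝ → ℝ) (ε : ℝ) (V m₀ m₁ : EuclideanSpace ℝ (Fin d) → ℝ)
        (u m : ℝ → EuclideanSpace ℝ (Fin d) → ℝ), IsCoupling f → 0 < ε →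
        IsPlanningOrPenalizedSolution Ω T H f ε V m₀ m₁ u m →
        (∀ t ∈ Ioo 0 T, ∀ x ∈ Ω, fEps f ε (m t x) + V x ≤ K) →
        ∀ t ∈ Ioo 0 T, ∀ x ∈ Ω,
          normalized Ω T m₁ u t x ≤ C₁ / (T - t) ^ (1 / (q - 1))) ∧
    -- local estimate from below
    (∀ f : ℝ → ℝ, IsCoupling f → (∃ c : ℝ, ∀ s ∈ Ioc (0 : ℝ) 1, c ≤ s * f s) →
      ∀ ε₀ R K : ℝ, ∃ C₀ : ℝ, ∀ (ε : ℝ) (V m₀ m₁ : EuclideanSpace ℝ (Fin d) → ℝ)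
        (u m : ℝ → EuclideanSpace ℝ (Fin d) → ℝ), 0 < ε → ε ≤ ε₀ →
        IsPlanningOrPenalizedSolution Ω T H f ε V m₀ m₁ u m →
        (∀ x ∈ Ω, |V x| ≤ R) →
        (∀ t ∈ Ioo 0 T, ∀ x ∈ Ω, fEps f ε (m t x) + V x ≤ K) →
        ∀ t ∈ Ioo 0 T, ∀ x ∈ Ω,
          -(C₀ / t ^ (1 / (q - 1))) ≤ normalized Ω T m₁ u t x) := by
  refine ⟨fun hH0 f hf ε₀ R => ?_, fun K => ?_, fun f hf hc ε₀ R K => ?_⟩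
  · obtain ⟨C, hC⟩ := PlanningProblem.global_estimate hq hH hH0 hΩ.convex hΩ.isOpen hΩ.bounded
      hΩ.nonempty hT hf ε₀ R
    exact ⟨C, fun ε V m₀ m₁ u m hε hε₀ h hm hl₀ hl₁ hf₀ hf₁ hV =>
      hC ε V m₀ m₁ u m hε hε₀ h hm hl₀ hl₁ hf₀ hf₁ hV.1⟩
  · obtain ⟨C₁, hC₁⟩ := PlanningProblem.local_upper_estimate hq hH hΩ.convex hΩ.isOpen hΩ.bounded
      hT K
    exact ⟨C₁, fun f ε V m₀ m₁ u m _ _ h hK => hC₁ f ε V m₀ m₁ u m h hK⟩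
  · obtain ⟨c, hc⟩ := hc
    exact PlanningProblem.local_lower_estimate hq hH hΩ.convex hΩ.isOpen hΩ.bounded hΩ.nonempty hT
      hf hc ε₀ R K
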